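/- (Wirthmüller isomorphism) A tensor-triangulated category is a triangulated category with a compatible closed symmetric monoidal structure $(\otimes,\mathbb 1,\underline{\mathrm{hom}})$ in the sense of Hovey–Palmieri–Strickland. An object $t$ is compact if $\mathrm{Hom}(t,-)$ sends coproducts to coproducts of abelian groups, and rigid if the natural map $\underline{\mathrm{hom}}(t,\mathbb 1)\otimes y\to\underline{\mathrm{hom}}(t,y)$ is an isomorphism for all $y$. The category is rigidly-compactly generated if it has arbitrary coproducts, there is a set $\mathcal G$ of compact objects such that $\mathrm{Hom}(g,t)=0$ for all $g\in\mathcal G$ implies $t=0$, and the compact objects are exactly the rigid objects. Let $\mathcal C,\mathcal D$ be rigidly-compactly generated tensor-triangulated categories and let $f^*:\mathcal D\to\mathcal C$ be a strong symmetric monoidal triangulated functor preserving arbitrary coproducts. Suppose that there are five adjoints $f_{(1)}\dashv f^*\dashv f_*\dashv f^{(1)}\dashv f_{(-1)}$ (Grothendieck–Neeman duality), and put $\omega_f:=f^{(1)}(\mathbb 1)\in\mathcal C$. Then the following are equivalent: (W1) $f_{(1)}$ admits a left adjoint; equivalently, $f_{(1)}$ preserves arbitrary products. (W2) $f_{(-1)}$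 admits a right adjoint; equivalently, $f_{(-1)}$ preserves arbitrary coproducts; equivalently, $f^{(1)}$ preserves compact objects. (W3) $\omega_f$ is compact. (W4) $\omega_f$ is $\otimes$-invertible. (W5) There is a $\otimes$-invertible object $\omega\in\mathcal C$ with $f_{(1)}\cong f_*(\omega\otimes-)$ or, equivalently (for the same $\omega$), with $f_*\cong f_{(1)}(\omega^{-1}\otimes-)$. (W6) There is an infinite tower of adjoints on both sides, that is, there are functors $f^{(n)}:\mathcal D\to\mathcal C$ and $f_{(n)}:\mathcal C\to\mathcal D$ for all $n\in\mathbb Z$ with $f^{(n)}\dashv f_{(-n)}\dashv f^{(n+1)}$ and $f^{(0)}\cong f^*$. All functors in a tower as in (W6) preserve coproducts, products and compact objects. When the conditions hold, any such tower is given, for all $n\in\mathbb Z$, by $f^{(n)}\cong\omega_f^{\otimes n}\otimes f^*(-)$ and $f_{(n)}\cong f_*(\omega_f^{\otimes n}\otimes-)$. Finally, (W1)–(W6) hold as soon as any one of the following holds: (1) $f_*$ is faithful (equivalently, every object of $\mathcal C$ is a direct summand of $f^*(y)$ for some $y\in\mathcal D$); (2) any $x\in\mathcal C$ is compact if $f_*(x)$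 is compact; (3) any $x\in\mathcal C$ is compact if $f_*(x\otimes y)$ is compact for every compact $y\in\mathcal C$. Moreover (1)$\Rightarrow$(2)$\Rightarrow$(3). -/

import Mathlib

open CategoryTheory Category Limits MonoidalCategory Pretriangulated Opposite

universe v u u₁ u₂

namespace TT

section Coproducts

variable {C : Type u₁} [Category.{v} C] {D : Type u₂} [Category.{v} D]

/-- The functor preserves arbitrary (small) coproducts. -/
def PreservesAllCoproducts (F : C ⥤ D) : Prop :=
  ∀ J : Type v, PreservesColimitsOfShape (Discrete J) F

/-- The functor preserves arbitrary (small) products. -/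
def PreservesAllProducts (F : C ⥤ D) : Prop :=
  ∀ J : Type v, PreservesLimitsOfShape (Discrete J) F

end Coproducts

section Compact

variable {C : Type u} [Category.{v} C] [Preadditive C]

/-- An object `t` is compact if `Hom(t, -)`, as a functor to abelian groups, preserves arbitrary
coproducts. -/
def IsCompactObj (t : C) : Prop :=
  PreservesAllCoproducts (preadditiveCoyoneda.obj (op t))

variable (C) in
/-- Existence of arbitrary coproducts and of a set of compact objects `G i` such that
`Hom(G i, t) = 0` for all `i` implies `t = 0`. -/
structure IsCompactlyGenerated : Prop where
  hasCoproducts : HasCoproducts.{v} C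
  exists_generators : ∃ (ι : Type v) (G : ι → C), (∀ i, IsCompactObj (G i)) ∧
    ∀ t : C, (∀ (i : ι) (φ : G i ⟶ t), φ = 0) → IsZero t

end Compact

/-- The functor preserves compact objects. -/
def PreservesCompacts {C : Type u₁} [Category.{v} C] [Preadditive C]
    {D : Type u₂} [Category.{v} D] [Preadditive D] (F : C ⥤ D) : Prop :=
  ∀ x : C, IsCompactObj x → IsCompactObj (F.obj x)

section Monoidal

variable {C : Type u} [Category.{v} C] [MonoidalCategory C]

/-- `x'` is a `⊗`-inverse of `x`; the categories considered below are symmetric, so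
one side is enough. -/
def IsTensorInverse (x x' : C) : Prop := Nonempty (x ⊗ x' ≅ 𝟙_ C)

/-- `⊗`-invertible objects. -/
def IsTensorInvertible (x : C) : Prop := ∃ x' : C, IsTensorInverse x x'

/-- The tensor power `x^{⊗ n}` for a natural number `n`. -/
def tensorPow (x : C) : ℕ → C
  | 0 => 𝟙_ C
  | n + 1 => x ⊗ tensorPow x n

/-- The tensor power `x^{⊗ n}` for an integer `n`, where `x'` is a `⊗`-inverse of `x`. -/
def tensorZPow (x x' : C) : ℤ → C
  | Int.ofNat n => tensorPow x n
  | Int.negSucc n => tensorPow x' (n + 1)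

variable [MonoidalClosed C]

/-- The natural map `hom(x, 𝟙) ⊗ y ⟶ hom(x, y)`, adjoint to
`x ⊗ (hom(x, 𝟙) ⊗ y) ≅ (x ⊗ hom(x, 𝟙)) ⊗ y ⟶ 𝟙 ⊗ y ≅ y`. -/
def dualTensorToHom (x y : C) :
    (ihom x).obj (𝟙_ C) ⊗ y ⟶ (ihom x).obj y :=
  MonoidalClosed.curry
    ((α_ x ((ihom x).obj (𝟙_ C)) y).inv ≫ ((ihom.ev x).app (𝟙_ C) ▷ y) ≫ (λ_ y).hom)

/-- Rigid (strongly dualizable) objects. -/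
def IsRigidObj (x : C) : Prop := ∀ y : C, IsIso (dualTensorToHom x y)

end Monoidal

section TensorTriangulated

variable {C : Type u} [Category.{v} C] [MonoidalCategory C] [SymmetricCategory C]
  [HasShift C ℤ]

/-- `x⟦n⟧ ⊗ y ⟶ (x ⊗ y)⟦n⟧`, deduced by symmetry from
the isomorphisms `y ⊗ x⟦n⟧ ≅ (y ⊗ x)⟦n⟧`. -/
def shiftTensor [∀ x : C, (tensorLeft x).CommShift ℤ] (x y : C) (n : ℤ) :
    x⟦n⟧ ⊗ y ⟶ (x ⊗ y)⟦n⟧ :=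
  (β_ (x⟦n⟧) y).hom ≫ ((tensorLeft y).commShiftIso n).hom.app x ≫ (β_ y x).hom⟦n⟧'

/-- The multiplication `𝟙⟦r⟧ ⊗ 𝟙⟦s⟧ ⟶ 𝟙⟦t⟧` of spheres, for `r + s = t`. -/
def sphereMul [∀ x : C, (tensorLeft x).CommShift ℤ] (r s t : ℤ) (h : r + s = t) :
    (𝟙_ C)⟦r⟧ ⊗ (𝟙_ C)⟦s⟧ ⟶ (𝟙_ C)⟦t⟧ :=
  ((tensorLeft ((𝟙_ C)⟦r⟧)).commShiftIso s).hom.app (𝟙_ C) ≫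
    (ρ_ ((𝟙_ C)⟦r⟧)).hom⟦s⟧' ≫ ((shiftFunctorAdd' C r s t h).inv.app (𝟙_ C))

/-- The canonical map `hom(x, w)⟦-1⟧ ⟶ hom(x⟦1⟧, w)`, adjoint to
`x⟦1⟧ ⊗ hom(x, w)⟦-1⟧ ≅ (x ⊗ hom(x, w)⟦-1⟧)⟦1⟧ ≅ x ⊗ hom(x, w)⟦-1⟧⟦1⟧ ≅ x ⊗ hom(x, w) ⟶ w`. -/
def ihomShift [MonoidalClosed C] [∀ x : C, (tensorLeft x).CommShift ℤ] (x w : C) :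
    ((ihom x).obj w)⟦(-1 : ℤ)⟧ ⟶ (ihom (x⟦(1 : ℤ)⟧)).obj w :=
  MonoidalClosed.curry
    (shiftTensor x (((ihom x).obj w)⟦(-1 : ℤ)⟧) 1 ≫
      ((tensorLeft x).commShiftIso (1 : ℤ)).inv.app (((ihom x).obj w)⟦(-1 : ℤ)⟧) ≫
      (x ◁ (shiftNegShift ((ihom x).obj w) (1 : ℤ)).hom) ≫
      (ihom.ev x).app w)

end TensorTriangulated

/-- A closed symmetric monoidal structure compatible with the triangulation, in the sense of
Hovey, Palmieri and Strickland. -/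
class TensorTriangulated (C : Type u) [Category.{v} C] [Preadditive C] [HasZeroObject C]
    [HasShift C ℤ] [∀ n : ℤ, (shiftFunctor C n).Additive] [Pretriangulated C]
    [MonoidalCategory C] [SymmetricCategory C] [MonoidalClosed C] where
  /-- The isomorphisms `x ⊗ y⟦n⟧ ≅ (x ⊗ y)⟦n⟧`, natural in `y`. -/
  commShift (x : C) : (tensorLeft x).CommShift ℤ
  /-- Naturality in `x`. -/
  commShift_natural {x x' : C} (φ : x ⟶ x') (y : C) (n : ℤ) :
    ((tensorLeft x).commShiftIso n).hom.app y ≫ (φ ▷ y)⟦n⟧' =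
      (φ ▷ (y⟦n⟧)) ≫ ((tensorLeft x').commShiftIso n).hom.app y
  /-- Compatibility with the unit isomorphism. -/
  commShift_unit (y : C) (n : ℤ) :
    ((tensorLeft (𝟙_ C)).commShiftIso n).hom.app y ≫ (λ_ y).hom⟦n⟧' = (λ_ (y⟦n⟧)).hom
  /-- Compatibility with the associativity isomorphism. -/
  commShift_assoc (x y z : C) (n : ℤ) :
    ((tensorLeft (x ⊗ y)).commShiftIso n).hom.app z ≫ (α_ x y z).hom⟦n⟧' =
      (α_ x y (z⟦n⟧)).hom ≫ (x ◁ ((tensorLeft y).commShiftIso n).hom.app z) ≫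
        ((tensorLeft x).commShiftIso n).hom.app (y ⊗ z)
  /-- The tensor product is exact in each variable. -/
  tensor_exact (x : C) : (tensorLeft x).IsTriangulated
  /-- The internal hom is exact in its contravariant variable (with the usual sign). -/
  ihom_exact (T : Triangle C) (hT : T ∈ distTriang C) (w : C) :
    Triangle.mk
      (-(ihomShift T.obj₁ w ≫ (MonoidalClosed.pre T.mor₃).app w))
      ((MonoidalClosed.pre T.mor₂).app w)
      ((MonoidalClosed.pre T.mor₁).app w ≫
        (shiftNegShift ((ihom T.obj₁).obj w) (1 : ℤ)).inv) ∈ distTriang C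
  /-- The symmetry of the tensor product of spheres is graded commutative. -/
  sphere_comm (r s t : ℤ) (h : r + s = t) (h' : s + r = t) :
    (β_ ((𝟙_ C)⟦r⟧) ((𝟙_ C)⟦s⟧)).hom ≫ sphereMul s r t h' =
      (r * s).negOnePow • sphereMul r s t h

attribute [reducible] TensorTriangulated.commShift
attribute [instance] TensorTriangulated.commShift TensorTriangulated.tensor_exact

/-- Compactly generated, and the compact objects are exactly the rigid objects. -/
structure IsRigidlyCompactlyGenerated (C : Type u) [Category.{v} C] [Preadditive C]
    [MonoidalCategory C] [MonoidalClosed C] : Prop where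
  isCompactlyGenerated : IsCompactlyGenerated C
  compact_iff_rigid : ∀ x : C, IsCompactObj x ↔ IsRigidObj x

/-- A doubly infinite tower of adjoints
`⋯ ⊣ up n ⊣ down (-n) ⊣ up (n + 1) ⊣ down (-(n + 1)) ⊣ ⋯` with `up 0 ≅ F`. -/
structure AdjointTower {C : Type u₁} [Category.{v} C] {D : Type u₂} [Category.{v} D]
    (F : D ⥤ C) where
  /-- The functors `f^{(n)}`. -/
  up : ℤ → (D ⥤ C)
  /-- The functors `f_{(n)}`. -/
  down : ℤ → (C ⥤ D)
  upZeroIso : up 0 ≅ F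
  adjUp (n : ℤ) : up n ⊣ down (-n)
  adjDown (n : ℤ) : down (-n) ⊣ up (n + 1)

end TT

/-!
Everything in a compactly generated category is a telescope of cells built from compact objects, so
a natural transformation between exact functors preserving coproducts is invertible once it is so
on compact objects. As compact objects are rigid, this gives the projection formula for `f_*`.
Together with the adjunction `f_* ⊣ f^{(1)}`, whose counit `f_* ω ⟶ 𝟙` serves as a trace, it makes
the pairing of `f_* (ω ⊗ x)` with `f_*` of the dual of `x` perfect for compact `x`, and hence
`f^* ≅ hom(ω, f^{(1)} -)`. Taking left adjoints, `f_{(1)} ≅ f_* (ω ⊗ -)`; evaluating at `𝟙`,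
`hom(ω, ω) ≅ 𝟙`.

Thus `ω` is invertible as soon as `hom(ω, 𝟙) ⊗ ω ⟶ hom(ω, ω)` is an isomorphism. It is one when `ω`
is rigid; if instead `f_{(1)}` preserves products, both sides of `hom(z, 𝟙) ⊗ ω ⟶ hom(z, ω)` turn
coproducts in `z` into products, and one reduces to rigid `z`. Conversely, twisting
`f^* ⊣ f_*` by the powers of an invertible `ω` gives the whole tower, and adjoints are unique.
-/

namespace TT

section CompactObjects

lemma preservesColimitsOfShape_of_retract {A : Type*} [Category* A] {B : Type*} [Category* B]
    {J : Type*} [Category* J] {F G : A ⥤ B} (h : Retract F G) [PreservesColimitsOfShape J G] :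
    PreservesColimitsOfShape J F where
  preservesColimit {K} :=
    { preserves {c} hc := by
        have hG := isColimitOfPreserves G hc
        have hir (X : A) : h.i.app X ≫ h.r.app X = 𝟙 _ := NatTrans.congr_app h.retract X
        let t (s : Cocone (K ⋙ F)) : Cocone (K ⋙ G) :=
          (Cocone.precompose (Functor.whiskerLeft K h.r)).obj s
        have hr (s : Cocone (K ⋙ F)) (m : F.obj c.pt ⟶ s.pt)
            (hm : ∀ j, F.map (c.ι.app j) ≫ m = s.ι.app j) : h.r.app c.pt ≫ m = hG.desc (t s) := by
          refine hG.uniq (t s) _ fun j => ?_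
          rw [Functor.mapCocone_ι_app, ← assoc, h.r.naturality, assoc, hm]
          rfl
        refine ⟨{ desc s := h.i.app c.pt ≫ hG.desc (t s), fac s j := ?_, uniq s m hm := ?_ }⟩
        · have hfac : G.map (c.ι.app j) ≫ hG.desc (t s) = h.r.app (K.obj j) ≫ s.ι.app j :=
            hG.fac (t s) j
          rw [Functor.mapCocone_ι_app, ← assoc, h.i.naturality, assoc, hfac, ← assoc, hir]
          exact id_comp (s.ι.app j)
        · rw [← hr s m hm, ← assoc, hir]
          exact (id_comp m).symm }

variable {C : Type u₁} [Category.{v} C] [Preadditive C]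

lemma IsCompactObj.of_retract {x y : C} (hy : IsCompactObj y) (r : Retract x y) :
    IsCompactObj x := fun J => by
  have := hy J
  exact preservesColimitsOfShape_of_retract
    { i := preadditiveCoyoneda.map r.r.op
      r := preadditiveCoyoneda.map r.i.op
      retract := by
        rw [← Functor.map_comp, ← op_comp, r.retract, op_id, CategoryTheory.Functor.map_id] }

lemma IsCompactObj.of_iso {x y : C} (hy : IsCompactObj y) (e : x ≅ y) : IsCompactObj x :=
  hy.of_retract ⟨e.hom, e.inv, e.hom_inv_id⟩

section HomToCoproduct

variable {d : C} (hd : IsCompactObj d) {J : Type*} [Small.{v} J] {X : J → C}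
include hd

lemma IsCompactObj.iSup_range_comp_inj {c : Cofan X} (hc : IsColimit c) :
    ⨆ j, (Preadditive.rightComp d (c.inj j)).range = ⊤ := by
  have := hd (Shrink.{v} J)
  have : PreservesColimitsOfShape (Discrete J) (preadditiveCoyoneda.obj (op d)) :=
    preservesColimitsOfShape_of_equiv (Discrete.equivalence (equivShrink J).symm) _
  let H := ⨆ j, (Preadditive.rightComp d (c.inj j)).range
  let q : (preadditiveCoyoneda.obj (op d)).obj c.pt ⟶ AddCommGrpCat.of ((d ⟶ c.pt) ⧸ H) :=
    AddCommGrpCat.ofHom (QuotientAddGroup.mk' H)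
  have hq : q = 0 := by
    refine (isColimitOfPreserves (preadditiveCoyoneda.obj (op d)) hc).hom_ext fun ⟨j⟩ => ?_
    ext (g : d ⟶ X j)
    exact (QuotientAddGroup.eq_zero_iff (g ≫ c.inj j)).2
      (AddSubgroup.mem_iSup_of_mem j ⟨g, rfl⟩)
  exact eq_top_iff.2 fun f _ =>
    (QuotientAddGroup.eq_zero_iff f).1 (ConcreteCategory.congr_hom hq f)

variable [HasCoproduct X]

lemma IsCompactObj.hom_sigma_induction {motive : (d ⟶ ∐ X) → Prop}
    (comp_ι : ∀ j (g : d ⟶ X j), motive (g ≫ Sigma.ι X j)) (zero : motive 0)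
    (add : ∀ f g, motive f → motive g → motive (f + g)) (f : d ⟶ ∐ X) : motive f := by
  have hf : f ∈ ⨆ j, (Preadditive.rightComp d (Sigma.ι X j)).range :=
    (hd.iSup_range_comp_inj (coproductIsCoproduct X)).symm ▸ AddSubgroup.mem_top f
  refine AddSubgroup.iSup_induction _ (C := motive) hf ?_ zero add
  rintro j _ ⟨g, rfl⟩
  exact comp_ι j g

variable [DecidableEq J]

lemma IsCompactObj.eventually_sum_comp_π_comp_ι_eq (f : d ⟶ ∐ X) :
    ∀ᶠ S : Finset J in Filter.atTop, ∑ j ∈ S, f ≫ Sigma.π X j ≫ Sigma.ι X j = f := by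
  induction f using hd.hom_sigma_induction (X := X) with
  | comp_ι j g =>
    filter_upwards [Filter.eventually_ge_atTop {j}] with S hS
    rw [Finset.sum_eq_single_of_mem j (Finset.singleton_subset_iff.1 hS), assoc,
      Sigma.ι_π_eq_id_assoc]
    intro k _ hk
    rw [assoc, Sigma.ι_π_of_ne_assoc _ hk.symm, zero_comp, comp_zero]
  | zero => simp
  | add f g hf hg =>
    filter_upwards [hf, hg] with S hf hg
    simp only [Preadditive.add_comp, Finset.sum_add_distrib, hf, hg]

lemma IsCompactObj.eq_zero_of_comp_π_eq_zero {f : d ⟶ ∐ X} (hf : ∀ j, f ≫ Sigma.π X j = 0) :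
    f = 0 := by
  obtain ⟨S, hS⟩ := (hd.eventually_sum_comp_π_comp_ι_eq f).exists
  rw [← hS]
  exact Finset.sum_eq_zero fun j _ => by rw [reassoc_of% (hf j), zero_comp]

end HomToCoproduct

end CompactObjects

section Adjunctions

variable {C : Type u₁} [Category.{v} C] {D : Type u₂} [Category.{v} D]

lemma PreservesAllCoproducts.of_isLeftAdjoint (F : C ⥤ D) [F.IsLeftAdjoint] :
    PreservesAllCoproducts F := fun _ => inferInstance

lemma PreservesAllProducts.of_isRightAdjoint (F : C ⥤ D) [F.IsRightAdjoint] :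
    PreservesAllProducts F := fun _ => inferInstance

variable [Preadditive C] [Preadditive D]

/-- For an adjunction `L ⊣ R`, the isomorphism `Hom(L x, -) ≅ Hom(x, R -)` of functors to abelian
groups. -/
noncomputable def preadditiveCoyonedaAdjIso {L : C ⥤ D} {R : D ⥤ C} [L.Additive] (adj : L ⊣ R)
    (x : C) : preadditiveCoyoneda.obj (op (L.obj x)) ≅ R ⋙ preadditiveCoyoneda.obj (op x) :=
  NatIso.ofComponents (fun y => (adj.homAddEquiv x y).toAddCommGrpIso) fun {y y'} f => by
    ext (g : L.obj x ⟶ y)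
    exact adj.homEquiv_naturality_right g f

lemma PreservesCompacts.of_adjunction {L : C ⥤ D} {R : D ⥤ C} [L.Additive] (adj : L ⊣ R)
    (hR : PreservesAllCoproducts R) : PreservesCompacts L := fun x hx J => by
  have := hR J
  have := hx J
  exact preservesColimitsOfShape_of_natIso (preadditiveCoyonedaAdjIso adj x).symm

lemma IsCompactObj.shift [HasShift C ℤ] [∀ n : ℤ, (shiftFunctor C n).Additive] {x : C}
    (hx : IsCompactObj x) (n : ℤ) : IsCompactObj (x⟦n⟧) :=
  have : (shiftEquiv C n).functor.Additive := inferInstanceAs (shiftFunctor C n).Additive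
  PreservesCompacts.of_adjunction (shiftEquiv C n).toAdjunction
    (.of_isLeftAdjoint (shiftFunctor C (-n))) x hx

end Adjunctions

section Telescope

variable {C : Type u} [Category.{v} C] [Preadditive C] {Y : ℕ → C} [HasCoproduct Y]
  (s : ∀ n, Y n ⟶ Y (n + 1))

/-- The map `1 - shift` on the coproduct of a sequence, whose cone is the telescope (homotopy
colimit) of the sequence. -/
noncomputable def oneSubShift : ∐ Y ⟶ ∐ Y :=
  Sigma.desc fun n => Sigma.ι Y n - s n ≫ Sigma.ι Y (n + 1)

lemma ι_oneSubShift_comp {W : C} (a : ∐ Y ⟶ W) (n : ℕ) :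
    Sigma.ι Y n ≫ oneSubShift s ≫ a = Sigma.ι Y n ≫ a - s n ≫ Sigma.ι Y (n + 1) ≫ a := by
  simp [oneSubShift]

lemma oneSubShift_π_zero : oneSubShift s ≫ Sigma.π Y 0 = Sigma.π Y 0 := by
  refine Sigma.hom_ext _ _ fun n => ?_
  rw [ι_oneSubShift_comp, Sigma.ι_π_of_ne _ n.succ_ne_zero, comp_zero, sub_zero]

lemma oneSubShift_π_succ (m : ℕ) :
    oneSubShift s ≫ Sigma.π Y (m + 1) = Sigma.π Y (m + 1) - Sigma.π Y m ≫ s m := by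
  refine Sigma.hom_ext _ _ fun n => ?_
  rw [ι_oneSubShift_comp, Preadditive.comp_sub]
  obtain rfl | hnm := eq_or_ne n m
  · rw [Sigma.ι_π_eq_id, Sigma.ι_π_eq_id_assoc, comp_id]
  · rw [Sigma.ι_π_of_ne _ (by lia : n + 1 ≠ m + 1), Sigma.ι_π_of_ne_assoc _ hnm, comp_zero,
      zero_comp]

lemma oneSubShift_comp_eq_zero_iff {W : C} (a : ∐ Y ⟶ W) :
    oneSubShift s ≫ a = 0 ↔ ∀ n, s n ≫ Sigma.ι Y (n + 1) ≫ a = Sigma.ι Y n ≫ a := by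
  refine ⟨fun ha n => ?_, fun ha => Sigma.hom_ext _ _ fun n => ?_⟩
  · have h := ι_oneSubShift_comp s a n
    rw [ha, comp_zero] at h
    exact (sub_eq_zero.1 h.symm).symm
  · rw [ι_oneSubShift_comp, ha, sub_self, comp_zero]

section MapsFromCompact

variable {s} {d : C}

lemma exists_comp_ι_comp_eq_of_le {W : C} {a : ∐ Y ⟶ W} (ha : oneSubShift s ≫ a = 0) {n m : ℕ}
    (hnm : n ≤ m) (g : d ⟶ Y n) :
    ∃ g' : d ⟶ Y m, g' ≫ Sigma.ι Y m ≫ a = g ≫ Sigma.ι Y n ≫ a := by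
  induction hnm with
  | refl => exact ⟨g, rfl⟩
  | @step m _ ih =>
    obtain ⟨g', hg'⟩ := ih
    exact ⟨g' ≫ s m, by rw [assoc, (oneSubShift_comp_eq_zero_iff s a).1 ha, hg']⟩

variable (hd : IsCompactObj d)
include hd

lemma IsCompactObj.eq_zero_of_comp_oneSubShift {h : d ⟶ ∐ Y} (hh : h ≫ oneSubShift s = 0) :
    h = 0 := by
  refine hd.eq_zero_of_comp_π_eq_zero fun m => ?_
  induction m with
  | zero => rw [← oneSubShift_π_zero s, reassoc_of% hh, zero_comp]
  | succ m ih =>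
    have hπ : Sigma.π Y (m + 1) = oneSubShift s ≫ Sigma.π Y (m + 1) + Sigma.π Y m ≫ s m := by
      rw [oneSubShift_π_succ, sub_add_cancel]
    rw [hπ, Preadditive.comp_add, reassoc_of% hh, reassoc_of% ih, zero_comp, zero_comp, add_zero]

lemma IsCompactObj.exists_comp_ι_comp_eq {W : C} {a : ∐ Y ⟶ W} (ha : oneSubShift s ≫ a = 0)
    (f : d ⟶ ∐ Y) : ∃ (N : ℕ) (g : d ⟶ Y N), g ≫ Sigma.ι Y N ≫ a = f ≫ a := by
  induction f using hd.hom_sigma_induction (X := Y) with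
  | comp_ι n g => exact ⟨n, g, (assoc _ _ _).symm⟩
  | zero => exact ⟨0, 0, by simp only [zero_comp]⟩
  | add f₁ f₂ h₁ h₂ =>
    obtain ⟨N₁, g₁, hg₁⟩ := h₁
    obtain ⟨N₂, g₂, hg₂⟩ := h₂
    obtain ⟨g₁', hg₁'⟩ := exists_comp_ι_comp_eq_of_le ha (le_max_left N₁ N₂) g₁
    obtain ⟨g₂', hg₂'⟩ := exists_comp_ι_comp_eq_of_le ha (le_max_right N₁ N₂) g₂
    exact ⟨max N₁ N₂, g₁' + g₂', by rw [Preadditive.add_comp, hg₁', hg₂', hg₁, hg₂,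
      Preadditive.add_comp]⟩

end MapsFromCompact

end Telescope

section Localizing

variable {C : Type u} [Category.{v} C] [Preadditive C] [HasZeroObject C] [HasShift C ℤ]
  [∀ n : ℤ, (shiftFunctor C n).Additive] [Pretriangulated C]

lemma exists_comp_mor₂_eq {T : Triangle C} (hT : T ∈ distTriang C) {d : C}
    (hd : ∀ k : d⟦(-1 : ℤ)⟧ ⟶ T.obj₁, k ≫ T.mor₁ = 0 → k = 0) (f : d ⟶ T.obj₃) :
    ∃ g : d ⟶ T.obj₂, f = g ≫ T.mor₂ := by
  refine Triangle.coyoneda_exact₃ T hT f ?_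
  obtain ⟨k, hk⟩ :=
    (shiftFunctor C (1 : ℤ)).map_surjective ((shiftNegShift d (1 : ℤ)).hom ≫ f ≫ T.mor₃)
  have hk₁ : k ≫ T.mor₁ = 0 := by
    refine (shiftFunctor C (1 : ℤ)).map_injective ?_
    rw [Functor.map_comp, hk, assoc, assoc, comp_distTriang_mor_zero₃₁ _ hT, comp_zero, comp_zero,
      Functor.map_zero]
  rw [← cancel_epi (shiftNegShift d (1 : ℤ)).hom, comp_zero, ← hk, hd k hk₁, Functor.map_zero]

lemma isDetecting_shift {ι : Type*} {G : ι → C}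
    (hG : ∀ t : C, (∀ (i : ι) (φ : G i ⟶ t), φ = 0) → IsZero t) :
    (ObjectProperty.ofObj fun k : ι × ℤ => (G k.1)⟦k.2⟧).IsDetecting := by
  intro X Y f hf
  obtain ⟨Z, g, h, hT⟩ := distinguished_cocone_triangle f
  refine (Triangle.isZero₃_iff_isIso₁ _ hT).1 (hG _ fun i φ => ?_)
  have hinj (k : (G i)⟦(-1 : ℤ)⟧ ⟶ X) (hk : k ≫ f = 0) : k = 0 :=
    (hf _ (ObjectProperty.ofObj_apply _ (i, (-1 : ℤ))) 0).unique hk zero_comp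
  obtain ⟨ψ, rfl⟩ : ∃ ψ : G i ⟶ Y, φ = ψ ≫ g := exists_comp_mor₂_eq hT hinj φ
  let e : (G i)⟦(0 : ℤ)⟧ ≅ G i := (shiftFunctorZero C ℤ).app (G i)
  obtain ⟨χ, hχ⟩ : ∃ χ, χ ≫ f = e.hom ≫ ψ :=
    (hf _ (ObjectProperty.ofObj_apply _ (i, (0 : ℤ))) _).exists
  have hfg : f ≫ g = 0 := comp_distTriang_mor_zero₁₂ _ hT
  exact (cancel_epi e.hom).1 (by rw [← reassoc_of% hχ, hfg, comp_zero]; exact comp_zero.symm)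

lemma IsCompactlyGenerated.exists_isDetecting (hC : IsCompactlyGenerated C) :
    ∃ (ι : Type v) (G : ι → C), (∀ i, IsCompactObj (G i)) ∧
      (ObjectProperty.ofObj G).IsDetecting := by
  obtain ⟨ι, G, hGc, hG⟩ := hC.exists_generators
  refine ⟨ι × ULift.{v} ℤ, fun k => (G k.1)⟦k.2.down⟧, fun k => (hGc k.1).shift k.2.down,
    (isDetecting_shift hG).of_le ?_⟩
  exact (ObjectProperty.ofObj_le_iff _ _).2 fun k =>
    ObjectProperty.ofObj_apply (fun k : ι × ULift.{v} ℤ => (G k.1)⟦k.2.down⟧) (k.1, ⟨k.2⟩)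

lemma IsCompactlyGenerated.isIso_of_bijective_comp (hC : IsCompactlyGenerated C) {X Y : C}
    (f : X ⟶ Y)
    (hf : ∀ d : C, IsCompactObj d → Function.Bijective (fun φ : d ⟶ X => φ ≫ f)) : IsIso f := by
  obtain ⟨ι, G, hGc, hG⟩ := hC.exists_isDetecting
  refine hG f ?_
  rintro _ ⟨i⟩
  exact (Function.bijective_iff_existsUnique _).1 (hf _ (hGc i))

lemma IsCompactObj.exists_comp_telescope {Y : ℕ → C} [HasCoproduct Y] {s : ∀ n, Y n ⟶ Y (n + 1)}
    {d W : C} (hd : IsCompactObj d) {a : ∐ Y ⟶ W} {b : W ⟶ (∐ Y)⟦(1 : ℤ)⟧}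
    (hT : Triangle.mk (oneSubShift s) a b ∈ distTriang C) (f : d ⟶ W) :
    ∃ (N : ℕ) (g : d ⟶ Y N), f = g ≫ Sigma.ι Y N ≫ a := by
  obtain ⟨f', rfl⟩ := exists_comp_mor₂_eq hT
    (fun k hk => (hd.shift (-1)).eq_zero_of_comp_oneSubShift hk) f
  obtain ⟨N, g, hg⟩ := hd.exists_comp_ι_comp_eq (comp_distTriang_mor_zero₁₂ _ hT) f'
  exact ⟨N, g, hg.symm⟩

lemma exists_oneSubShift_distTriang {ι : Type*} {G : ι → C} (hGc : ∀ i, IsCompactObj (G i))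
    (hG : (ObjectProperty.ofObj G).IsDetecting) {Y : ℕ → C} [HasCoproduct Y]
    (s : ∀ n, Y n ⟶ Y (n + 1)) {t : C} (q : ∀ n, Y n ⟶ t) (hq : ∀ n, s n ≫ q (n + 1) = q n)
    (hsurj : ∀ i (f : G i ⟶ t), ∃ f', f' ≫ q 0 = f)
    (hker : ∀ i N (f : G i ⟶ Y N), f ≫ q N = 0 → f ≫ s N = 0) :
    ∃ b, Triangle.mk (oneSubShift s) (Sigma.desc q) b ∈ distTriang C := by
  obtain ⟨W, a, b, hT⟩ := distinguished_cocone_triangle (oneSubShift s)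
  have hsq : oneSubShift s ≫ Sigma.desc q = 0 :=
    (oneSubShift_comp_eq_zero_iff s _).2 fun n => by rw [Sigma.ι_desc, Sigma.ι_desc, hq]
  obtain ⟨w, hw⟩ : ∃ w : W ⟶ t, Sigma.desc q = a ≫ w := Triangle.yoneda_exact₂ _ hT _ hsq
  have hιw (n : ℕ) : Sigma.ι Y n ≫ a ≫ w = q n := by rw [← hw, Sigma.ι_desc]
  have hιa (n : ℕ) : s n ≫ Sigma.ι Y (n + 1) ≫ a = Sigma.ι Y n ≫ a :=
    (oneSubShift_comp_eq_zero_iff s a).1 (comp_distTriang_mor_zero₁₂ _ hT) n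
  have hinj (i : ι) (f : G i ⟶ W) (hf : f ≫ w = 0) : f = 0 := by
    obtain ⟨N, g, rfl⟩ := (hGc i).exists_comp_telescope hT f
    have hgq : g ≫ q N = 0 := by rw [← hιw N, ← hf, assoc, assoc]
    rw [← hιa, reassoc_of% (hker i N g hgq), zero_comp]
  have : IsIso w := by
    refine hG w ?_
    rintro _ ⟨i⟩ f
    obtain ⟨f', rfl⟩ := hsurj i f
    refine ⟨f' ≫ Sigma.ι Y 0 ≫ a, by simp only [assoc, hιw], fun g hg => ?_⟩
    refine sub_eq_zero.1 (hinj i _ ?_)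
    simp only [Preadditive.sub_comp, assoc, hιw, hg, sub_self]
  have hwa : Sigma.desc q ≫ inv w = a := (IsIso.comp_inv_eq w).2 hw
  exact ⟨inv w ≫ b, isomorphic_distinguished _ hT _
    (Triangle.isoMk _ _ (Iso.refl _) (Iso.refl _) (asIso w).symm
      ((comp_id _).trans (id_comp _).symm) (hwa.trans (id_comp a).symm)
      ((congrArg _ (CategoryTheory.Functor.map_id _ _)).trans (comp_id _)))⟩

section Induction

variable [HasCoproducts.{v} C] {ι : Type v} {G : ι → C} (P : ObjectProperty C)
  [P.IsClosedUnderIsomorphisms] [P.IsTriangulatedClosed₃]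
  [∀ J : Type v, P.IsClosedUnderColimitsOfShape (Discrete J)] (hP : ∀ i, P (G i))
include hP

lemma exists_cone_annihilating_kernel {A t : C} (hA : P A) (p : A ⟶ t) :
    ∃ (B : C) (_ : P B) (s : A ⟶ B) (q : B ⟶ t), s ≫ q = p ∧
      ∀ i (f : G i ⟶ A), f ≫ p = 0 → f ≫ s = 0 := by
  let X (k : Σ i, {f : G i ⟶ A // f ≫ p = 0}) : C := G k.1
  let d : ∐ X ⟶ A := Sigma.desc fun k => k.2.1
  obtain ⟨B, s, δ, hT⟩ := distinguished_cocone_triangle d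
  have hB : P B := P.ext_of_isTriangulatedClosed₃ _ hT (P.prop_colimit _ fun k => hP _) hA
  have hdp : d ≫ p = 0 := Sigma.hom_ext _ _ fun k => by rw [Sigma.ι_desc_assoc, k.2.2, comp_zero]
  obtain ⟨q, hq⟩ := Triangle.yoneda_exact₂ _ hT p hdp
  refine ⟨B, hB, s, q, hq.symm, fun i f hf => ?_⟩
  have hfd : Sigma.ι X ⟨i, f, hf⟩ ≫ d = f := Sigma.ι_desc _ _
  rw [← hfd, assoc, show d ≫ s = 0 from comp_distTriang_mor_zero₁₂ _ hT, comp_zero]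

lemma exists_cellular_tower (t : C) :
    ∃ (Y : ℕ → C) (_ : ∀ n, P (Y n)) (s : ∀ n, Y n ⟶ Y (n + 1)) (q : ∀ n, Y n ⟶ t),
      (∀ n, s n ≫ q (n + 1) = q n) ∧ (∀ i (f : G i ⟶ t), ∃ f', f' ≫ q 0 = f) ∧
        ∀ i n (f : G i ⟶ Y n), f ≫ q n = 0 → f ≫ s n = 0 := by
  choose B hB s q hq hker using fun A : {A : Over t // P A.left} =>
    exists_cone_annihilating_kernel P hP A.2 A.1.hom
  let X (k : Σ i, G i ⟶ t) : C := G k.1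
  let A₀ : {A : Over t // P A.left} :=
    ⟨Over.mk (Sigma.desc fun k => k.2 : ∐ X ⟶ t), P.prop_colimit _ fun k => hP _⟩
  let A (n : ℕ) : {A : Over t // P A.left} :=
    Nat.rec A₀ (fun _ A => ⟨Over.mk (q A), hB A⟩) n
  exact ⟨fun n => (A n).1.left, fun n => (A n).2, fun n => s (A n), fun n => (A n).1.hom,
    fun n => hq (A n), fun i f => ⟨Sigma.ι X ⟨i, f⟩, Sigma.ι_desc _ _⟩, fun i n => hker (A n) i⟩

lemma prop_of_isDetecting (hGc : ∀ i, IsCompactObj (G i))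
    (hG : (ObjectProperty.ofObj G).IsDetecting) (t : C) : P t := by
  have : HasCoproducts.{0} C := hasCoproducts_shrink
  have : P.IsClosedUnderColimitsOfShape (Discrete ℕ) :=
    .of_equivalence (Discrete.equivalence Equiv.ulift.{v})
  obtain ⟨Y, hY, s, q, hq, hsurj, hker⟩ := exists_cellular_tower P hP t
  obtain ⟨b, hT⟩ := exists_oneSubShift_distTriang hGc hG s q hq hsurj hker
  have hY' : P (∐ Y) := P.prop_colimit _ fun n => hY n.as
  exact P.ext_of_isTriangulatedClosed₃ _ hT hY' hY'

end Induction

theorem IsCompactlyGenerated.induction (hC : IsCompactlyGenerated C) (P : ObjectProperty C)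
    [P.IsClosedUnderIsomorphisms] [∀ J : Type v, P.IsClosedUnderColimitsOfShape (Discrete J)]
    (hcpt : ∀ x, IsCompactObj x → P x)
    (hcone : ∀ T ∈ distTriang C, P T.obj₁ → P T.obj₂ → P (T.obj₁⟦(1 : ℤ)⟧) →
      P (T.obj₂⟦(1 : ℤ)⟧) → P T.obj₃) (t : C) : P t := by
  have := hC.hasCoproducts
  obtain ⟨ι, G, hGc, hG⟩ := hC.exists_isDetecting
  let Q : ObjectProperty C := fun x => ∀ n : ℤ, P (x⟦n⟧)
  have : Q.IsClosedUnderIsomorphisms :=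
    ⟨fun e h n => P.prop_of_iso ((shiftFunctor C n).mapIso e) (h n)⟩
  have : Q.IsTriangulatedClosed₃ := .mk' fun T hT h₁ h₂ n =>
    hcone _ (Triangle.shift_distinguished T hT n) (h₁ n) (h₂ n)
      (P.prop_of_iso ((shiftFunctorAdd C n 1).app T.obj₁) (h₁ (n + 1)))
      (P.prop_of_iso ((shiftFunctorAdd C n 1).app T.obj₂) (h₂ (n + 1)))
  have (J : Type v) : Q.IsClosedUnderColimitsOfShape (Discrete J) :=
    ⟨fun x ⟨h⟩ n => (P.inverseImage (shiftFunctor C n)).colimitsOfShape_le _ _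
      ⟨h.ofLE fun _ hy => hy n⟩⟩
  have hQ : Q t := prop_of_isDetecting Q (fun i n => hcpt _ ((hGc i).shift n)) hGc hG t
  exact P.prop_of_iso ((shiftFunctorZero C ℤ).app t) (hQ 0)

end Localizing

section IsoObjects

variable {A : Type*} [Category* A] {B : Type*} [Category* B] {F G : A ⥤ B} (τ : F ⟶ G)

/-- The property of objects at which the natural transformation `τ` is an isomorphism. -/
def isoObjects : ObjectProperty A := fun X => IsIso (τ.app X)

instance : (isoObjects τ).IsClosedUnderIsomorphisms :=
  ⟨fun e h => (NatTrans.isIso_app_iff_of_iso τ e).1 h⟩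

variable (J : Type*) [Category* J]

instance [PreservesColimitsOfShape J F] [PreservesColimitsOfShape J G] :
    (isoObjects τ).IsClosedUnderColimitsOfShape J where
  colimitsOfShape_le := by
    rintro X ⟨h⟩
    have (j : J) : IsIso ((Functor.whiskerLeft h.diag τ).app j) := h.prop_diag_obj j
    have := NatIso.isIso_of_isIso_app (Functor.whiskerLeft h.diag τ)
    exact isIso_app_coconePt_of_preservesColimit h.diag τ h.cocone h.isColimit

instance [PreservesLimitsOfShape J F] [PreservesLimitsOfShape J G] :
    (isoObjects τ).IsClosedUnderLimitsOfShape J where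
  limitsOfShape_le := by
    rintro X ⟨h⟩
    have (j : J) : IsIso ((Functor.whiskerLeft h.diag τ).app j) := h.prop_diag_obj j
    have := NatIso.isIso_of_isIso_app (Functor.whiskerLeft h.diag τ)
    have hF := isLimitOfPreserves F h.isLimit
    have hG := isLimitOfPreserves G h.isLimit
    let e := hF.conePointsIsoOfNatIso hG (asIso (Functor.whiskerLeft h.diag τ))
    have he : e.hom = τ.app X := hG.hom_ext fun j => by
      rw [IsLimit.conePointsIsoOfNatIso_hom_comp]
      exact τ.naturality (h.π.app j)
    have : IsIso (τ.app X) := he ▸ e.isIso_hom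
    exact this

end IsoObjects

section FiveLemma

lemma isIso_app_of_exact {A : Type*} [Category* A] {H K : A ⥤ AddCommGrpCat.{v}} (τ : H ⟶ K)
    {x₁ x₂ x₃ x₄ x₅ : A} {f₁ : x₁ ⟶ x₂} {f₂ : x₂ ⟶ x₃} {f₃ : x₃ ⟶ x₄} {f₄ : x₄ ⟶ x₅}
    (hH₁ : Function.Exact (H.map f₁) (H.map f₂)) (hH₂ : Function.Exact (H.map f₂) (H.map f₃))
    (hH₃ : Function.Exact (H.map f₃) (H.map f₄)) (hK₁ : Function.Exact (K.map f₁) (K.map f₂))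
    (hK₂ : Function.Exact (K.map f₂) (K.map f₃)) (hK₃ : Function.Exact (K.map f₃) (K.map f₄))
    (h₁ : IsIso (τ.app x₁)) (h₂ : IsIso (τ.app x₂)) (h₄ : IsIso (τ.app x₄))
    (h₅ : IsIso (τ.app x₅)) : IsIso (τ.app x₃) := by
  have hτ {x y : A} (f : x ⟶ y) :
      (K.map f).hom.comp (τ.app x).hom = (τ.app y).hom.comp (H.map f).hom := by
    rw [← AddCommGrpCat.hom_comp, ← AddCommGrpCat.hom_comp, τ.naturality]
  rw [ConcreteCategory.isIso_iff_bijective] at *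
  exact AddMonoidHom.bijective_of_surjective_of_bijective_of_bijective_of_injective
    (H.map f₁).hom (H.map f₂).hom (H.map f₃).hom (H.map f₄).hom
    (K.map f₁).hom (K.map f₂).hom (K.map f₃).hom (K.map f₄).hom
    (τ.app x₁).hom (τ.app x₂).hom (τ.app x₃).hom (τ.app x₄).hom (τ.app x₅).hom
    (hτ f₁) (hτ f₂) (hτ f₃) (hτ f₄) hH₁ hH₂ hH₃ hK₁ hK₂ hK₃ h₁.surjective h₂ h₄ h₅.injective

variable {C : Type u₁} [Category.{v} C] [Preadditive C] [HasZeroObject C] [HasShift C ℤ]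
  [∀ n : ℤ, (shiftFunctor C n).Additive] [Pretriangulated C]

lemma function_exact_of_isHomological (H : C ⥤ AddCommGrpCat.{v}) [H.IsHomological]
    {T : Triangle C} (hT : T ∈ distTriang C) :
    Function.Exact (H.map T.mor₁) (H.map T.mor₂) :=
  (ShortComplex.ab_exact_iff_function_exact _).1 (H.map_distinguished_exact T hT)

lemma isIso_app_obj₃_of_isHomological {H K : C ⥤ AddCommGrpCat.{v}} [H.IsHomological]
    [K.IsHomological] (τ : H ⟶ K) {T : Triangle C} (hT : T ∈ distTriang C)
    (h₁ : IsIso (τ.app T.obj₁)) (h₂ : IsIso (τ.app T.obj₂))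
    (h₁' : IsIso (τ.app (T.obj₁⟦(1 : ℤ)⟧))) (h₂' : IsIso (τ.app (T.obj₂⟦(1 : ℤ)⟧))) :
    IsIso (τ.app T.obj₃) := by
  have hT' := rot_of_distTriang _ hT
  have hT'' := rot_of_distTriang _ hT'
  exact isIso_app_of_exact τ
    (function_exact_of_isHomological H hT) (function_exact_of_isHomological H hT')
    (function_exact_of_isHomological H hT'') (function_exact_of_isHomological K hT)
    (function_exact_of_isHomological K hT') (function_exact_of_isHomological K hT'') h₁ h₂ h₁' h₂'

lemma isIso_app_op_obj₃_of_exact {H K : Cᵒᵖ ⥤ AddCommGrpCat.{v}} (τ : H ⟶ K)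
    (hH : ∀ T ∈ distTriang C, Function.Exact (H.map T.mor₂.op) (H.map T.mor₁.op))
    (hK : ∀ T ∈ distTriang C, Function.Exact (K.map T.mor₂.op) (K.map T.mor₁.op))
    {T : Triangle C} (hT : T ∈ distTriang C)
    (h₁ : IsIso (τ.app (op T.obj₁))) (h₂ : IsIso (τ.app (op T.obj₂)))
    (h₁' : IsIso (τ.app (op (T.obj₁⟦(1 : ℤ)⟧)))) (h₂' : IsIso (τ.app (op (T.obj₂⟦(1 : ℤ)⟧)))) :
    IsIso (τ.app (op T.obj₃)) := by
  have hT' := rot_of_distTriang _ hT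
  have hT'' := rot_of_distTriang _ hT'
  exact isIso_app_of_exact τ (hH _ hT'') (hH _ hT') (hH _ hT) (hK _ hT'') (hK _ hT') (hK _ hT)
    h₂' h₁' h₂ h₁

end FiveLemma

section ExactTransformations

variable {C : Type u₁} [Category.{v} C] [Preadditive C] [HasZeroObject C] [HasShift C ℤ]
  [∀ n : ℤ, (shiftFunctor C n).Additive] [Pretriangulated C]

lemma IsCompactlyGenerated.isIso_app_iff (hC : IsCompactlyGenerated C) {A : Type*} [Category* A]
    {F G : A ⥤ C} (τ : F ⟶ G) (x : A) : IsIso (τ.app x) ↔ ∀ d : C, IsCompactObj d →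
      IsIso ((Functor.whiskerRight τ (preadditiveCoyoneda.obj (op d))).app x) := by
  refine ⟨fun _ d _ => (preadditiveCoyoneda.obj (op d)).map_isIso (τ.app x),
    fun h => hC.isIso_of_bijective_comp _ fun d hd => ?_⟩
  exact (ConcreteCategory.isIso_iff_bijective _).1 (h d hd)

theorem IsCompactlyGenerated.isIso_app {D : Type u₂} [Category.{v} D] [Preadditive D]
    [HasZeroObject D] [HasShift D ℤ] [∀ n : ℤ, (shiftFunctor D n).Additive] [Pretriangulated D]
    (hC : IsCompactlyGenerated C) (hD : IsCompactlyGenerated D) {F G : C ⥤ D}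
    [F.CommShift ℤ] [F.IsTriangulated] [G.CommShift ℤ] [G.IsTriangulated]
    (hF : PreservesAllCoproducts F) (hG : PreservesAllCoproducts G) (τ : F ⟶ G)
    (hτ : ∀ x, IsCompactObj x → IsIso (τ.app x)) (x : C) : IsIso (τ.app x) := by
  have (J : Type v) : (isoObjects τ).IsClosedUnderColimitsOfShape (Discrete J) :=
    have := hF J
    have := hG J
    inferInstance
  refine hC.induction (isoObjects τ) hτ (fun T hT h₁ h₂ h₁' h₂' => ?_) x
  refine (hD.isIso_app_iff τ _).2 fun d hd => ?_
  exact isIso_app_obj₃_of_isHomological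
    (Functor.whiskerRight τ (preadditiveCoyoneda.obj (op d))) hT
    ((hD.isIso_app_iff τ _).1 h₁ d hd) ((hD.isIso_app_iff τ _).1 h₂ d hd)
    ((hD.isIso_app_iff τ _).1 h₁' d hd) ((hD.isIso_app_iff τ _).1 h₂' d hd)

end ExactTransformations

open Functor.LaxMonoidal Functor.OplaxMonoidal

section Rigid

variable {C : Type u} [Category.{v} C] [MonoidalCategory C]

lemma whiskerLeft_zigzag_comp_evaluation {b t : C} {c : 𝟙_ C ⟶ b ⊗ t} {e : t ⊗ b ⟶ 𝟙_ C}
    (h : t ◁ c ≫ (α_ t b t).inv ≫ e ▷ t = (ρ_ t).hom ≫ (λ_ t).inv) :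
    t ◁ (c ▷ b ≫ (α_ b t b).hom ≫ b ◁ e) ≫ (α_ t b (𝟙_ C)).inv ≫ e ▷ 𝟙_ C =
      t ◁ ((λ_ b).hom ≫ (ρ_ b).inv) ≫ (α_ t b (𝟙_ C)).inv ≫ e ▷ 𝟙_ C := by
  have h' : t ◁ c ⊗≫ e ▷ t = ⊗𝟙.hom := by
    convert! h using 1 <;> simp [monoidalComp]
  calc
    _ = 𝟙 _ ⊗≫ t ◁ c ▷ b ⊗≫ ((t ⊗ b) ◁ e ≫ e ▷ 𝟙_ C) := by monoidal
    _ = 𝟙 _ ⊗≫ (t ◁ c ⊗≫ e ▷ t) ▷ b ⊗≫ e ⊗≫ 𝟙 _ := by rw [whisker_exchange]; monoidal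
    _ = _ := by rw [h']; monoidal

section Closed

variable [MonoidalClosed C]

lemma uncurry_comp_dualTensorToHom {t y z : C} (h : z ⟶ (ihom t).obj (𝟙_ C) ⊗ y) :
    MonoidalClosed.uncurry (h ≫ dualTensorToHom t y) =
      t ◁ h ≫ (α_ _ _ _).inv ≫ ((ihom.ev t).app (𝟙_ C) ▷ y) ≫ (λ_ y).hom := by
  rw [MonoidalClosed.uncurry_natural_left, dualTensorToHom, MonoidalClosed.uncurry_curry]

/-- The duality between a rigid object `t` and `hom(t, 𝟙)`, with evaluation the counit of the
tensor-hom adjunction. In Mathlib's convention `t` is the right dual of `hom(t, 𝟙)`. -/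
@[reducible]
noncomputable def exactPairingOfIsRigidObj {t : C} (ht : IsRigidObj t) :
    ExactPairing ((ihom t).obj (𝟙_ C)) t :=
  have := ht t
  have := ht (𝟙_ C)
  let c := MonoidalClosed.curry (ρ_ t).hom ≫ inv (dualTensorToHom t t)
  have h : t ◁ c ≫ (α_ _ _ _).inv ≫ ((ihom.ev t).app (𝟙_ C)) ▷ t = (ρ_ t).hom ≫ (λ_ t).inv := by
    have hc : c ≫ dualTensorToHom t t = MonoidalClosed.curry (ρ_ t).hom := by
      rw [assoc, IsIso.inv_hom_id, comp_id]
    rw [Iso.eq_comp_inv, assoc, assoc, ← uncurry_comp_dualTensorToHom, hc,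
      MonoidalClosed.uncurry_curry]
  { coevaluation' := c
    evaluation' := (ihom.ev t).app (𝟙_ C)
    coevaluation_evaluation' := h
    evaluation_coevaluation' := by
      rw [← cancel_mono (dualTensorToHom t (𝟙_ C))]
      apply MonoidalClosed.uncurry_injective
      rw [uncurry_comp_dualTensorToHom, uncurry_comp_dualTensorToHom]
      simpa only [assoc] using whiskerLeft_zigzag_comp_evaluation h =≫ (λ_ (𝟙_ C)).hom }

variable (C) in
lemma isRigidObj_unit : IsRigidObj (𝟙_ C) := fun y => by
  have : (tensorLeft (𝟙_ C)).IsEquivalence := Functor.isEquivalence_of_iso (leftUnitorNatIso C).symm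
  have : (ihom (𝟙_ C)).IsEquivalence :=
    (ihom.adjunction (𝟙_ C)).isEquivalence_right_of_isEquivalence_left
  have hev : IsIso ((ihom.ev (𝟙_ C)).app (𝟙_ C)) :=
    inferInstanceAs (IsIso ((ihom.adjunction (𝟙_ C)).counit.app (𝟙_ C)))
  have hcoev : IsIso ((ihom.coev (𝟙_ C)).app ((ihom (𝟙_ C)).obj (𝟙_ C) ⊗ y)) :=
    inferInstanceAs (IsIso ((ihom.adjunction (𝟙_ C)).unit.app _))
  rw [dualTensorToHom, MonoidalClosed.curry_eq]
  infer_instance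

end Closed

lemma bijective_whiskerRight_comp_evaluation (r r' : C) [ExactPairing r r'] (z : C) :
    Function.Bijective (fun g : z ⟶ r' => g ▷ r ≫ ε_ r r') := by
  let E : (z ⟶ r') ≃ (z ⊗ r ⟶ 𝟙_ C) :=
    (Iso.homCongr (Iso.refl z) (λ_ r').symm).trans (tensorRightHomEquiv z r r' (𝟙_ C)).symm
  convert! E.bijective using 2 with g
  simp [E, tensorRightHomEquiv, ← unitors_equal]

lemma bijective_of_perfect_pairing {r r' b : C} [ExactPairing r r'] (e : b ⊗ r ⟶ 𝟙_ C)
    (he : ∀ z : C, Function.Bijective (fun g : z ⟶ b => g ▷ r ≫ e)) (y : C) :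
    Function.Bijective (fun ψ : 𝟙_ C ⟶ r ⊗ y =>
      (ρ_ b).inv ≫ b ◁ ψ ≫ (α_ _ _ _).inv ≫ e ▷ y ≫ (λ_ y).hom) := by
  obtain ⟨i, hi⟩ : ∃ i : b ⟶ r', i ▷ r ≫ ε_ r r' = e :=
    (bijective_whiskerRight_comp_evaluation r r' b).surjective e
  have : IsIso i := by
    refine isIso_of_yoneda_map_bijective i fun z => ?_
    refine (Function.Bijective.of_comp_iff'
      (bijective_whiskerRight_comp_evaluation r r' z) _).1 ?_
    convert! he z using 2 with g
    simp [← hi]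
  let E : (𝟙_ C ⟶ r ⊗ y) ≃ (b ⟶ y) :=
    (tensorLeftHomEquiv (𝟙_ C) r r' y).symm.trans
      (Iso.homCongr ((ρ_ r') ≪≫ (asIso i).symm) (Iso.refl y))
  convert! E.bijective using 2 with ψ
  simp only [← hi, comp_whiskerRight, assoc, tensorLeftHomEquiv, Equiv.coe_trans,
    Function.comp_apply, Equiv.coe_fn_symm_mk, Iso.homCongr_apply, Iso.trans_inv, Iso.symm_inv,
    asIso_hom, Iso.refl_hom, comp_id, E]
  rw [← associator_inv_naturality_left_assoc, whisker_exchange_assoc,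
    ← rightUnitor_inv_naturality_assoc]

end Rigid

section MapPairing

variable {C : Type u₁} [Category.{v} C] [MonoidalCategory C]
  {D : Type u₂} [Category.{v} D] [MonoidalCategory D]

/-- The image of an exact pairing under a strong monoidal functor. -/
@[reducible]
noncomputable def exactPairingMap (F : D ⥤ C) [F.Monoidal] (X Y : D) [ExactPairing X Y] :
    ExactPairing (F.obj X) (F.obj Y) where
  coevaluation' := ε F ≫ F.map (η_ X Y) ≫ δ F X Y
  evaluation' := μ F Y X ≫ F.map (ε_ X Y) ≫ η F
  coevaluation_evaluation' := by
    have h : μ F Y (𝟙_ D) ≫ F.map (Y ◁ η_ X Y ≫ (α_ _ _ _).inv ≫ ε_ X _ ▷ Y) ≫ δ F (𝟙_ D) Y =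
      μ F Y (𝟙_ D) ≫ F.map ((ρ_ Y).hom ≫ (λ_ Y).inv) ≫ δ F (𝟙_ D) Y := by
        rw [ExactPairing.coevaluation_evaluation]
    simp only [Functor.map_comp, Functor.Monoidal.map_whiskerLeft,
      Functor.Monoidal.map_whiskerRight, Functor.Monoidal.map_associator_inv, assoc,
      Functor.Monoidal.μ_δ_assoc, Functor.Monoidal.μ_δ, comp_id] at h
    simp [reassoc_of% h]
  evaluation_coevaluation' := by
    have h : μ F (𝟙_ D) X ≫ F.map (η_ X Y ▷ X ≫ (α_ _ _ _).hom ≫ X ◁ ε_ X Y) ≫ δ F X (𝟙_ D) =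
      μ F (𝟙_ D) X ≫ F.map ((λ_ X).hom ≫ (ρ_ X).inv) ≫ δ F X (𝟙_ D) := by
        rw [ExactPairing.evaluation_coevaluation]
    simp only [Functor.map_comp, Functor.Monoidal.map_whiskerLeft,
      Functor.Monoidal.map_whiskerRight, Functor.Monoidal.map_associator, assoc,
      Functor.Monoidal.μ_δ_assoc, Functor.Monoidal.μ_δ, comp_id] at h
    simp [reassoc_of% h]

end MapPairing

section Projection

variable {C : Type u₁} [Category.{v} C] [MonoidalCategory C]
  {D : Type u₂} [Category.{v} D] [MonoidalCategory D]

section Oplax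

variable {F : D ⥤ C} [F.OplaxMonoidal] {R : C ⥤ D} (adj : F ⊣ R)

/-- The morphism `R x ⊗ y ⟶ R (x ⊗ F y)` of the projection formula for a functor `F` with right
adjoint `R`. -/
def projMap (x : C) (y : D) : R.obj x ⊗ y ⟶ R.obj (x ⊗ F.obj y) :=
  adj.homEquiv _ _ (δ F (R.obj x) y ≫ adj.counit.app x ▷ F.obj y)

/-- The morphism `y ⊗ R x ⟶ R (F y ⊗ x)` of the projection formula, with the factors in the other
order. -/
def projMapLeft (y : D) (x : C) : y ⊗ R.obj x ⟶ R.obj (F.obj y ⊗ x) :=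
  adj.homEquiv _ _ (δ F y (R.obj x) ≫ F.obj y ◁ adj.counit.app x)

lemma projMap_natural_left {x x' : C} (f : x ⟶ x') (y : D) :
    R.map f ▷ y ≫ projMap adj x' y = projMap adj x y ≫ R.map (f ▷ F.obj y) := by
  rw [projMap, projMap, ← adj.homEquiv_naturality_left, ← adj.homEquiv_naturality_right]
  congr 1
  simp [← δ_natural_left_assoc, ← comp_whiskerRight]

lemma projMap_natural_right (x : C) {y y' : D} (f : y ⟶ y') :
    R.obj x ◁ f ≫ projMap adj x y' = projMap adj x y ≫ R.map (x ◁ F.map f) := by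
  rw [projMap, projMap, ← adj.homEquiv_naturality_left, ← adj.homEquiv_naturality_right]
  congr 1
  simp [← δ_natural_right_assoc, whisker_exchange]

/-- The projection morphism `R x ⊗ y ⟶ R (x ⊗ F y)` as a natural transformation in `y`. -/
@[simps]
def projTrans (x : C) : tensorLeft (R.obj x) ⟶ F ⋙ tensorLeft x ⋙ R where
  app y := projMap adj x y
  naturality _ _ f := projMap_natural_right adj x f

section Lax

variable [R.LaxMonoidal] [adj.IsMonoidal]

lemma projMap_eq_unit_comp_μ (x : C) (y : D) :
    projMap adj x y = R.obj x ◁ adj.unit.app y ≫ μ R _ _ := by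
  apply (adj.homEquiv _ _).symm.injective
  rw [projMap, Equiv.symm_apply_apply, adj.homEquiv_counit, F.map_comp, assoc,
    adj.map_μ_comp_counit_app_tensor, tensorHom_def']
  refine .trans ?_ (δ_natural_right_assoc F (R.obj x) (adj.unit.app y) _)
  simp [← MonoidalCategory.whiskerLeft_comp_assoc]

lemma projMapLeft_eq_unit_comp_μ (y : D) (x : C) :
    projMapLeft adj y x = adj.unit.app y ▷ R.obj x ≫ μ R _ _ := by
  apply (adj.homEquiv _ _).symm.injective
  rw [projMapLeft, Equiv.symm_apply_apply, adj.homEquiv_counit, F.map_comp, assoc,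
    adj.map_μ_comp_counit_app_tensor, MonoidalCategory.tensorHom_def]
  refine .trans ?_ (δ_natural_left_assoc F (adj.unit.app y) (R.obj x) _)
  simp [← comp_whiskerRight_assoc]

lemma whiskerRight_μ_comp_projMap (s a : C) (y : D) :
    (α_ _ _ _).inv ≫ μ R s a ▷ y ≫ projMap adj (s ⊗ a) y =
      R.obj s ◁ projMap adj a y ≫ μ R s (a ⊗ F.obj y) ≫ R.map (α_ _ _ _).inv := by
  rw [projMap_eq_unit_comp_μ, projMap_eq_unit_comp_μ, ← whisker_exchange_assoc,
    ← associator_inv_naturality_right_assoc, MonoidalCategory.whiskerLeft_comp, assoc]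
  exact congrArg _ (Functor.LaxMonoidal.associativity_inv R s a (F.obj y)).symm

end Lax

end Oplax

lemma isIso_projMap_of_exactPairing {F : D ⥤ C} [F.Monoidal] {R : C ⥤ D} (adj : F ⊣ R)
    (x : C) (y' y : D) [ExactPairing y' y] : IsIso (projMap adj x y) := by
  let := exactPairingMap F y' y
  refine isIso_of_yoneda_map_bijective _ fun d => ?_
  let E : (d ⟶ R.obj x ⊗ y) ≃ (d ⟶ R.obj (x ⊗ F.obj y)) :=
    (tensorRightHomEquiv d y' y (R.obj x)).symm.trans <|
      (adj.homEquiv _ _).symm.trans <|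
      (Iso.homCongr (Functor.Monoidal.μIso F d y').symm (Iso.refl x)).trans <|
      (tensorRightHomEquiv (F.obj d) (F.obj y') (F.obj y) x).trans (adj.homEquiv _ _)
  convert! E.bijective using 2 with f
  rw [← (adj.homEquiv _ _).symm.injective.eq_iff,
    ← (tensorRightHomEquiv (F.obj d) (F.obj y') (F.obj y) x).symm.injective.eq_iff]
  simp only [E, Equiv.trans_apply, Equiv.symm_apply_apply]
  rw [Adjunction.homEquiv_naturality_left_symm]
  simp only [projMap, Equiv.symm_apply_apply, tensorRightHomEquiv, Equiv.coe_fn_symm_mk]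
  have hev : ε_ (F.obj y') (F.obj y) = μ F y y' ≫ F.map (ε_ y' y) ≫ η F := rfl
  rw [hev]
  simp only [Adjunction.homEquiv_counit, comp_whiskerRight, assoc, Iso.homCongr_apply,
    Iso.symm_inv, Functor.Monoidal.μIso_hom, Iso.refl_hom, comp_id, Functor.map_comp,
    MonoidalCategory.whiskerLeft_comp, Functor.Monoidal.map_whiskerRight,
    Functor.Monoidal.map_whiskerLeft, Functor.Monoidal.map_associator,
    Functor.Monoidal.map_rightUnitor, Functor.Monoidal.μ_δ_assoc]
  have hc := rightUnitor_naturality (adj.counit.app x)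
  have ha := associator_naturality_left (adj.counit.app x) (F.obj y) (F.obj y')
  dsimp at hc ha
  rw [← hc, whisker_exchange_assoc, whisker_exchange_assoc, whisker_exchange_assoc,
    reassoc_of% ha]

lemma projMapLeft_eq_braiding_comp_projMap [SymmetricCategory C] [BraidedCategory D] {F : D ⥤ C}
    [F.Braided] {R : C ⥤ D} (adj : F ⊣ R) (y : D) (x : C) :
    projMapLeft adj y x = (β_ y (R.obj x)).hom ≫ projMap adj x y ≫ R.map (β_ _ _).hom := by
  rw [projMapLeft, projMap, ← adj.homEquiv_naturality_right, ← adj.homEquiv_naturality_left]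
  congr 1
  simp

end Projection

section TraceDuality

variable {C : Type u₁} [Category.{v} C] [MonoidalCategory C]
  {D : Type u₂} [Category.{v} D] [MonoidalCategory D] {R : C ⥤ D} [R.LaxMonoidal]

/-- The pairing `R (w ⊗ x) ⊗ R a ⟶ R w ⟶ 𝟙` given by a duality between `a` and `x` and a trace
`t : R w ⟶ 𝟙`. -/
def tracePairing {w : C} (t : R.obj w ⟶ 𝟙_ D) (a x : C) [ExactPairing a x] :
    R.obj (w ⊗ x) ⊗ R.obj a ⟶ 𝟙_ D :=
  μ R _ _ ≫ R.map ((α_ w x a).hom ≫ w ◁ ε_ a x ≫ (ρ_ w).hom) ≫ t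

lemma bijective_whiskerRight_comp_tracePairing {F : D ⥤ C} [F.OplaxMonoidal] (adj : F ⊣ R)
    [adj.IsMonoidal] {w : C} (t : R.obj w ⟶ 𝟙_ D)
    (ht : ∀ z : C, Function.Bijective (fun g : z ⟶ w => R.map g ≫ t)) (a x : C) [ExactPairing a x]
    (z : D) [IsIso (projMapLeft adj z a)] :
    Function.Bijective (fun g : z ⟶ R.obj (w ⊗ x) => g ▷ R.obj a ≫ tracePairing t a x) := by
  let E : (z ⟶ R.obj (w ⊗ x)) ≃ (z ⊗ R.obj a ⟶ 𝟙_ D) :=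
    (adj.homEquiv _ _).symm.trans <|
      (tensorRightHomEquiv (F.obj z) a x w).symm.trans <|
      (Equiv.ofBijective _ (ht _)).trans
      (Iso.homCongr (asIso (projMapLeft adj z a)).symm (Iso.refl _))
  convert! E.bijective using 2 with g
  obtain ⟨g, rfl⟩ := (adj.homEquiv _ _).surjective g
  simp only [E, Equiv.trans_apply, Equiv.symm_apply_apply]
  simp only [tracePairing, tensorRightHomEquiv, Equiv.coe_fn_symm_mk, Equiv.ofBijective_apply,
    Iso.homCongr_apply, Iso.symm_inv, asIso_hom, Iso.refl_hom, comp_id,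
    projMapLeft_eq_unit_comp_μ, assoc, adj.homEquiv_unit]
  generalize adj.unit.app z = u
  change z ⟶ R.obj (F.obj z) at u
  simp only [Functor.map_comp, comp_whiskerRight, assoc, μ_natural_left_assoc]

variable {F : D ⥤ C} [F.Monoidal] (adj : F ⊣ R)

/-- The bijection between maps `𝟙 ⟶ R a ⊗ y` and maps `x ⟶ F y`, given by the projection formula
and a duality between `a` and `x`. -/
noncomputable def projTranspose (a x : C) [ExactPairing a x] (y : D) [IsIso (projMap adj a y)] :
    (𝟙_ D ⟶ R.obj a ⊗ y) ≃ (x ⟶ F.obj y) :=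
  (Iso.homCongr (Iso.refl _) (asIso (projMap adj a y))).trans <|
    (adj.homEquiv _ _).symm.trans <|
    (Iso.homCongr (Functor.Monoidal.εIso F).symm (Iso.refl _)).trans <|
    (tensorLeftHomEquiv (𝟙_ C) a x (F.obj y)).symm.trans
    (Iso.homCongr (ρ_ x) (Iso.refl _))

variable [adj.IsMonoidal]

lemma exists_comp_projMap_eq (a x : C) [ExactPairing a x] (y : D) [IsIso (projMap adj a y)]
    (ψ : 𝟙_ D ⟶ R.obj a ⊗ y) :
    ∃ χ : 𝟙_ C ⟶ a ⊗ F.obj y, ψ ≫ projMap adj a y = ε R ≫ R.map χ ∧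
      projTranspose adj a x y ψ =
        (ρ_ x).inv ≫ x ◁ χ ≫ (α_ _ _ _).inv ≫ ε_ a x ▷ _ ≫ (λ_ _).hom := by
  obtain ⟨ψ', hψ'⟩ := (adj.homEquiv (𝟙_ D) (a ⊗ F.obj y)).surjective (ψ ≫ projMap adj a y)
  refine ⟨ε F ≫ ψ', ?_, by simp [projTranspose, ← hψ', tensorLeftHomEquiv]⟩
  rw [← hψ', ← adj.unit_app_unit_comp_map_η, adj.homEquiv_unit, assoc, ← R.map_comp,
    Functor.Monoidal.η_ε_assoc]

lemma whiskerLeft_comp_whiskerRight_μ_comp_projMap {w : C} (a x : C) [ExactPairing a x] (y : D)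
    {ψ : 𝟙_ D ⟶ R.obj a ⊗ y} {χ : 𝟙_ C ⟶ a ⊗ F.obj y}
    (h : ψ ≫ projMap adj a y = ε R ≫ R.map χ) :
    R.obj (w ⊗ x) ◁ ψ ≫ (α_ _ _ _).inv ≫ μ R _ _ ▷ y ≫
        R.map ((α_ w x a).hom ≫ w ◁ ε_ a x ≫ (ρ_ w).hom) ▷ y ≫ projMap adj w y =
      (ρ_ _).hom ≫ R.map (w ◁ ((ρ_ x).inv ≫ x ◁ χ ≫ (α_ _ _ _).inv ≫
        ε_ a x ▷ _ ≫ (λ_ _).hom)) := by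
  have hμ := whiskerRight_μ_comp_projMap adj (w ⊗ x) a y
  rw [projMap_natural_left, reassoc_of% hμ, ← MonoidalCategory.whiskerLeft_comp_assoc, h,
    MonoidalCategory.whiskerLeft_comp, assoc, μ_natural_right_assoc,
    Functor.LaxMonoidal.right_unitality]
  simp only [assoc, ← R.map_comp]
  congr 3
  monoidal

theorem bijective_map_whiskerLeft_comp_trace {w : C} (t : R.obj w ⟶ 𝟙_ D)
    (ht : ∀ z : C, Function.Bijective (fun g : z ⟶ w => R.map g ≫ t)) (a x : C) [ExactPairing a x]
    {r : D} [ExactPairing (R.obj a) r] (y : D) [∀ z, IsIso (projMapLeft adj z a)]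
    [IsIso (projMap adj a y)] [IsIso (projMap adj w y)] :
    Function.Bijective (fun φ : x ⟶ F.obj y =>
      R.map (w ◁ φ) ≫ inv (projMap adj w y) ≫ t ▷ y ≫ (λ_ y).hom) := by
  have hb := bijective_of_perfect_pairing (r' := r) (tracePairing t a x)
    (fun z => bijective_whiskerRight_comp_tracePairing adj t ht a x z) y
  refine (Function.Bijective.of_comp_iff _ (projTranspose adj a x y).bijective).1 ?_
  convert! hb using 2 with ψ
  obtain ⟨χ, hψ, hφ⟩ := exists_comp_projMap_eq adj a x y ψ
  have hχ := whiskerLeft_comp_whiskerRight_μ_comp_projMap adj (w := w) a x y hψ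
  rw [Function.comp_apply, hφ, ← cancel_epi (ρ_ _).hom, ← reassoc_of% hχ]
  simp [tracePairing, -Functor.LaxMonoidal.right_unitality]

end TraceDuality

section TensorCompact

variable {C : Type u} [Category.{v} C] [Preadditive C] [MonoidalCategory C]
  [MonoidalClosed C]

lemma IsRigidlyCompactlyGenerated.isCompactObj_unit (hC : IsRigidlyCompactlyGenerated C) :
    IsCompactObj (𝟙_ C) :=
  (hC.compact_iff_rigid _).2 (isRigidObj_unit C)

lemma IsRigidlyCompactlyGenerated.isCompactObj_of_exactPairing
    (hC : IsRigidlyCompactlyGenerated C) (y x : C) [ExactPairing y x] [(tensorLeft x).Additive] :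
    IsCompactObj x :=
  (PreservesCompacts.of_adjunction (tensorLeftAdjunction y x) (.of_isLeftAdjoint _) _
    hC.isCompactObj_unit).of_iso (ρ_ x).symm

lemma IsRigidlyCompactlyGenerated.exists_exactPairing [BraidedCategory C]
    (hC : IsRigidlyCompactlyGenerated C) [∀ x : C, (tensorLeft x).Additive] {x : C}
    (hx : IsCompactObj x) :
    ∃ a : C, Nonempty (ExactPairing a x) ∧ Nonempty (ExactPairing x a) ∧ IsCompactObj a := by
  let e := exactPairingOfIsRigidObj ((hC.compact_iff_rigid x).1 hx)
  let e' := BraidedCategory.exactPairing_swap ((ihom x).obj (𝟙_ C)) x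
  exact ⟨_, ⟨e⟩, ⟨e'⟩, hC.isCompactObj_of_exactPairing x _⟩

end TensorCompact

section DualizingMap

variable {C : Type u₁} [Category.{v} C] [MonoidalCategory C] [MonoidalClosed C]
  {D : Type u₂} [Category.{v} D] [MonoidalCategory D] {F : D ⥤ C} {R : C ⥤ D} {U : D ⥤ C}

/-- For `F ⊣ R ⊣ U` satisfying the projection formula, the map `F y ⟶ hom(U 𝟙, U y)` adjoint to
`R (U 𝟙 ⊗ F y) ≅ R (U 𝟙) ⊗ y ⟶ 𝟙 ⊗ y ≅ y`. -/
noncomputable def toIhomDualizing [F.OplaxMonoidal] (adj₂ : F ⊣ R) (adj₃ : R ⊣ U)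
    [∀ y, IsIso (projMap adj₂ (U.obj (𝟙_ D)) y)] : F ⟶ U ⋙ ihom (U.obj (𝟙_ D)) where
  app y := MonoidalClosed.curry (adj₃.homEquiv _ _
    (inv (projMap adj₂ (U.obj (𝟙_ D)) y) ≫ adj₃.counit.app (𝟙_ D) ▷ y ≫ (λ_ y).hom))
  naturality y y' f := by
    have hproj : R.map (U.obj (𝟙_ D) ◁ F.map f) ≫ inv (projMap adj₂ (U.obj (𝟙_ D)) y') =
        inv (projMap adj₂ (U.obj (𝟙_ D)) y) ≫ R.obj (U.obj (𝟙_ D)) ◁ f := by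
      rw [IsIso.eq_inv_comp, ← assoc, ← projMap_natural_right, assoc, IsIso.hom_inv_id, comp_id]
    have hexch := whisker_exchange_assoc (adj₃.counit.app (𝟙_ D)) f (λ_ y').hom
    dsimp at hexch ⊢
    rw [← MonoidalClosed.curry_natural_left, ← MonoidalClosed.curry_natural_right,
      ← adj₃.homEquiv_naturality_left, ← adj₃.homEquiv_naturality_right, reassoc_of% hproj, hexch,
      leftUnitor_naturality, assoc, assoc]

lemma bijective_comp_toIhomDualizing [F.Monoidal] (adj₂ : F ⊣ R) (adj₃ : R ⊣ U)
    [∀ y, IsIso (projMap adj₂ (U.obj (𝟙_ D)) y)] (a x : C) [ExactPairing a x] {r : D}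
    [ExactPairing (R.obj a) r] (y : D) [∀ z, IsIso (projMapLeft adj₂ z a)]
    [IsIso (projMap adj₂ a y)] :
    Function.Bijective (fun φ : x ⟶ F.obj y => φ ≫ (toIhomDualizing adj₂ adj₃).app y) := by
  let := adj₂.rightAdjointLaxMonoidal
  have htrace (z : C) : Function.Bijective
      (fun g : z ⟶ U.obj (𝟙_ D) => R.map g ≫ adj₃.counit.app (𝟙_ D)) := by
    convert! (adj₃.homEquiv z (𝟙_ D)).symm.bijective using 2
  let E : (R.obj (U.obj (𝟙_ D) ⊗ x) ⟶ y) ≃ (x ⟶ (ihom (U.obj (𝟙_ D))).obj (U.obj y)) :=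
    (adj₃.homEquiv _ _).trans ((ihom.adjunction (U.obj (𝟙_ D))).homEquiv _ _)
  convert! E.bijective.comp
    (bijective_map_whiskerLeft_comp_trace adj₂ _ htrace a x (r := r) y) using 2
  simp only [toIhomDualizing, E, Function.comp_apply, Equiv.trans_apply]
  rw [adj₃.homEquiv_naturality_left, MonoidalClosed.homEquiv_apply_eq,
    MonoidalClosed.curry_natural_left]

end DualizingMap

section Duality

variable {C : Type u₁} [Category.{v} C] [Preadditive C] [HasZeroObject C] [HasShift C ℤ]
  [∀ n : ℤ, (shiftFunctor C n).Additive] [Pretriangulated C]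
  [MonoidalCategory C] [SymmetricCategory C] [MonoidalClosed C] [TensorTriangulated C]
  {D : Type u₂} [Category.{v} D] [Preadditive D] [HasZeroObject D] [HasShift D ℤ]
  [∀ n : ℤ, (shiftFunctor D n).Additive] [Pretriangulated D]
  [MonoidalCategory D] [SymmetricCategory D] [MonoidalClosed D] [TensorTriangulated D]
  {F : D ⥤ C} [F.CommShift ℤ] [F.IsTriangulated] {R : C ⥤ D} {U : D ⥤ C}

theorem isIso_projMap [F.Monoidal] (hD : IsRigidlyCompactlyGenerated D) (adj : F ⊣ R)
    (hR : PreservesAllCoproducts R) (x : C) (y : D) : IsIso (projMap adj x y) := by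
  let := adj.rightAdjointCommShift ℤ
  have := adj.commShift_of_leftAdjoint ℤ
  have := adj.isTriangulated_rightAdjoint
  have := adj.isLeftAdjoint
  have hG : PreservesAllCoproducts (F ⋙ tensorLeft x ⋙ R) := fun J =>
    have := hR J
    inferInstance
  refine hD.isCompactlyGenerated.isIso_app hD.isCompactlyGenerated
    (.of_isLeftAdjoint (tensorLeft (R.obj x))) hG (projTrans adj x) (fun y hy => ?_) y
  obtain ⟨y', ⟨_⟩, -, -⟩ := hD.exists_exactPairing hy
  exact isIso_projMap_of_exactPairing adj x y' y

theorem isIso_projMapLeft [F.Braided] (hD : IsRigidlyCompactlyGenerated D) (adj : F ⊣ R)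
    (hR : PreservesAllCoproducts R) (y : D) (x : C) : IsIso (projMapLeft adj y x) := by
  have := isIso_projMap hD adj hR x y
  rw [projMapLeft_eq_braiding_comp_projMap]
  infer_instance

theorem isIso_toIhomDualizing [F.Braided] (hC : IsRigidlyCompactlyGenerated C)
    (hD : IsRigidlyCompactlyGenerated D) (adj₂ : F ⊣ R) (adj₃ : R ⊣ U)
    (hU : PreservesAllCoproducts U) [∀ y, IsIso (projMap adj₂ (U.obj (𝟙_ D)) y)] :
    IsIso (toIhomDualizing adj₂ adj₃) := by
  have hR : PreservesAllCoproducts R := have := adj₃.isLeftAdjoint; .of_isLeftAdjoint R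
  have (y : D) : IsIso ((toIhomDualizing adj₂ adj₃).app y) := by
    refine hC.isCompactlyGenerated.isIso_of_bijective_comp _ fun x hx => ?_
    obtain ⟨a, ⟨_⟩, -, ha⟩ := hC.exists_exactPairing hx
    have := adj₂.right_adjoint_additive
    have hRa : IsCompactObj (R.obj a) := PreservesCompacts.of_adjunction adj₃ hU a ha
    obtain ⟨r, -, ⟨_⟩, -⟩ := hD.exists_exactPairing hRa
    have := isIso_projMap hD adj₂ hR a y
    have := fun z => isIso_projMapLeft hD adj₂ hR z a
    exact bijective_comp_toIhomDualizing adj₂ adj₃ a x (r := r) y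
  exact NatIso.isIso_of_isIso_app _

/-- The duality isomorphism `F ≅ hom(U 𝟙, U -)` given by `toIhomDualizing`. -/
noncomputable def isoIhomDualizing [F.Braided] (hC : IsRigidlyCompactlyGenerated C)
    (hD : IsRigidlyCompactlyGenerated D) (adj₂ : F ⊣ R) (adj₃ : R ⊣ U)
    (hU : PreservesAllCoproducts U) :
    F ≅ U ⋙ ihom (U.obj (𝟙_ D)) :=
  have := adj₃.isLeftAdjoint
  have := isIso_projMap hD adj₂ (.of_isLeftAdjoint R) (U.obj (𝟙_ D))
  have := isIso_toIhomDualizing hC hD adj₂ adj₃ hU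
  asIso (toIhomDualizing adj₂ adj₃)

end Duality

section DualTensor

variable {C : Type u} [Category.{v} C] [MonoidalCategory C] [MonoidalClosed C]

lemma dualTensorToHom_natural {z z' : C} (f : z ⟶ z') (w : C) :
    (MonoidalClosed.pre f).app (𝟙_ C) ▷ w ≫ dualTensorToHom z w =
      dualTensorToHom z' w ≫ (MonoidalClosed.pre f).app w := by
  apply MonoidalClosed.uncurry_injective
  rw [uncurry_comp_dualTensorToHom, MonoidalClosed.uncurry_pre_app, dualTensorToHom,
    MonoidalClosed.uncurry_curry, associator_inv_naturality_middle_assoc,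
    ← comp_whiskerRight_assoc, MonoidalClosed.id_tensor_pre_app_comp_ev,
    comp_whiskerRight_assoc, ← associator_inv_naturality_left_assoc]

/-- The maps `hom(z, 𝟙) ⊗ w ⟶ hom(z, w)`, as a natural transformation in `z`. -/
@[simps]
noncomputable def dualTensorToHomTrans (w : C) :
    MonoidalClosed.internalHom.flip.obj (𝟙_ C) ⋙ tensorRight w ⟶
      MonoidalClosed.internalHom.flip.obj w where
  app z := dualTensorToHom z.unop w
  naturality _ _ f := dualTensorToHom_natural f.unop w

end DualTensor

section Contravariant

variable {C : Type u} [Category.{v} C] [Preadditive C] [HasZeroObject C] [HasShift C ℤ]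
  [∀ n : ℤ, (shiftFunctor C n).Additive] [Pretriangulated C]

lemma IsCompactlyGenerated.isClosedUnderLimitsOfShape_isoObjects (hC : IsCompactlyGenerated C)
    {A : Type*} [Category* A] {J : Type v} [SmallCategory J] {F G : A ⥤ C}
    [PreservesLimitsOfShape J G]
    (hF : ∀ d : C, IsCompactObj d →
      PreservesLimitsOfShape J (F ⋙ preadditiveCoyoneda.obj (op d))) (τ : F ⟶ G) :
    (isoObjects τ).IsClosedUnderLimitsOfShape J where
  limitsOfShape_le := by
    rintro x ⟨h⟩
    refine (hC.isIso_app_iff τ x).2 fun d hd => ?_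
    have := hF d hd
    exact (isoObjects (Functor.whiskerRight τ (preadditiveCoyoneda.obj (op d)))).prop_of_isLimit
      h.isLimit fun j => (hC.isIso_app_iff τ _).1 (h.prop_diag_obj j) d hd

variable [MonoidalCategory C] [SymmetricCategory C] [MonoidalClosed C] [TensorTriangulated C]

lemma isHomological_tensorRight_comp (w : C) (H : C ⥤ AddCommGrpCat.{v}) [H.IsHomological] :
    (tensorRight w ⋙ H).IsHomological :=
  .of_iso (Functor.isoWhiskerRight (BraidedCategory.tensorLeftIsoTensorRight w) H)

lemma function_exact_internalHom_flip_comp (H : C ⥤ AddCommGrpCat.{v}) [H.IsHomological] (w : C)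
    {T : Triangle C} (hT : T ∈ distTriang C) :
    Function.Exact ((MonoidalClosed.internalHom.flip.obj w ⋙ H).map T.mor₂.op)
      ((MonoidalClosed.internalHom.flip.obj w ⋙ H).map T.mor₁.op) := by
  let e := (shiftNegShift ((ihom T.obj₁).obj w) (1 : ℤ)).inv
  have hexact : Function.Exact (H.map ((MonoidalClosed.pre T.mor₂).app w))
      (H.map ((MonoidalClosed.pre T.mor₁).app w ≫ e)) :=
    function_exact_of_isHomological H
      (rot_of_distTriang _ (TensorTriangulated.ihom_exact T hT w))
  have he : Function.Injective (H.map e) :=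
    ((ConcreteCategory.isIso_iff_bijective (H.map e)).1 inferInstance).injective
  have hexact' : Function.Exact (H.map ((MonoidalClosed.pre T.mor₂).app w))
      (H.map ((MonoidalClosed.pre T.mor₁).app w)) := fun y => by
    rw [← hexact y, Functor.map_comp, ConcreteCategory.comp_apply]
    exact (map_eq_zero_iff (H.map e).hom he).symm
  exact hexact'

lemma isIso_dualTensorToHom_obj₃ (hC : IsCompactlyGenerated C) (w : C) {T : Triangle C}
    (hT : T ∈ distTriang C) (h₁ : IsIso (dualTensorToHom T.obj₁ w))
    (h₂ : IsIso (dualTensorToHom T.obj₂ w)) (h₁' : IsIso (dualTensorToHom (T.obj₁⟦(1 : ℤ)⟧) w))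
    (h₂' : IsIso (dualTensorToHom (T.obj₂⟦(1 : ℤ)⟧) w)) :
    IsIso (dualTensorToHom T.obj₃ w) := by
  refine (hC.isIso_app_iff (dualTensorToHomTrans w) (op T.obj₃)).2 fun d hd => ?_
  let H := preadditiveCoyoneda.obj (op d)
  have hτ {x : C} (hx : IsIso (dualTensorToHom x w)) :
      IsIso ((Functor.whiskerRight (dualTensorToHomTrans w) H).app (op x)) :=
    (hC.isIso_app_iff (dualTensorToHomTrans w) (op x)).1 hx d hd
  have := isHomological_tensorRight_comp w H
  exact isIso_app_op_obj₃_of_exact (Functor.whiskerRight (dualTensorToHomTrans w) H)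
    (fun _ => function_exact_internalHom_flip_comp (tensorRight w ⋙ H) (𝟙_ C))
    (fun _ => function_exact_internalHom_flip_comp H w) hT (hτ h₁) (hτ h₂) (hτ h₁') (hτ h₂')

theorem isIso_dualTensorToHom_of_preservesAllProducts (hC : IsRigidlyCompactlyGenerated C) {w : C}
    (hw : ∀ d : C, IsCompactObj d →
      PreservesAllProducts (tensorRight w ⋙ preadditiveCoyoneda.obj (op d))) (z : C) :
    IsIso (dualTensorToHom z w) := by
  have (J : Type v) : (isoObjects (dualTensorToHomTrans w)).IsClosedUnderLimitsOfShape
      (Discrete J)ᵒᵖ := by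
    refine hC.isCompactlyGenerated.isClosedUnderLimitsOfShape_isoObjects
      (F := MonoidalClosed.internalHom.flip.obj (𝟙_ C) ⋙ tensorRight w) (fun d hd => ?_) _
    have := hw d hd J
    have : PreservesLimitsOfShape (Discrete J)ᵒᵖ
        (tensorRight w ⋙ preadditiveCoyoneda.obj (op d)) :=
      preservesLimitsOfShape_of_equiv (Discrete.opposite J).symm _
    exact inferInstanceAs (PreservesLimitsOfShape (Discrete J)ᵒᵖ
      (MonoidalClosed.internalHom.flip.obj (𝟙_ C) ⋙
        tensorRight w ⋙ preadditiveCoyoneda.obj (op d)))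
  exact hC.isCompactlyGenerated.induction (isoObjects (dualTensorToHomTrans w)).unop
    (fun x hx => (hC.compact_iff_rigid x).1 hx w)
    (fun _ hT h₁ h₂ h₁' h₂' =>
      isIso_dualTensorToHom_obj₃ hC.isCompactlyGenerated w hT h₁ h₂ h₁' h₂') z

end Contravariant

section Invertible

lemma isTensorInverse_unit (C : Type u) [Category.{v} C] [MonoidalCategory C] :
    IsTensorInverse (𝟙_ C) (𝟙_ C) :=
  ⟨λ_ _⟩

variable {C : Type u} [Category.{v} C] [MonoidalCategory C] [BraidedCategory C] {x x' : C}

lemma IsTensorInverse.symm (h : IsTensorInverse x x') : IsTensorInverse x' x :=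
  h.map fun e => β_ x' x ≪≫ e

/-- Tensoring with an invertible object, as an equivalence; the quasi-inverse is tensoring with
the inverse object. -/
noncomputable def IsTensorInverse.equivalence (h : IsTensorInverse x x') : C ≌ C :=
  .mk (tensorLeft x) (tensorLeft x')
    ((leftUnitorNatIso C).symm ≪≫ (curriedTensor C).mapIso h.symm.some.symm ≪≫
      tensorLeftTensor x' x)
    ((tensorLeftTensor x x').symm ≪≫ (curriedTensor C).mapIso h.some ≪≫ leftUnitorNatIso C)

/-- The adjunction underlying `IsTensorInverse.equivalence`. -/
noncomputable def IsTensorInverse.adjunction (h : IsTensorInverse x x') :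
    tensorLeft x ⊣ tensorLeft x' :=
  h.equivalence.toAdjunction

lemma IsTensorInverse.nonempty_iso_comp_iff {A : Type*} [Category* A] (h : IsTensorInverse x x')
    (G H : C ⥤ A) :
    Nonempty (G ≅ tensorLeft x ⋙ H) ↔ Nonempty (H ≅ tensorLeft x' ⋙ G) :=
  ⟨fun ⟨e⟩ => ⟨Iso.isoInverseComp (G := h.equivalence) e.symm⟩,
    fun ⟨e⟩ => ⟨Iso.isoInverseComp (G := h.symm.equivalence) e.symm⟩⟩

lemma IsTensorInverse.tensor {y y' : C} (h : IsTensorInverse x x') (h' : IsTensorInverse y y') :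
    IsTensorInverse (x ⊗ y) (x' ⊗ y') := by
  obtain ⟨e⟩ := h
  obtain ⟨e'⟩ := h'
  exact ⟨α_ _ _ _ ≪≫ whiskerLeftIso x ((α_ _ _ _).symm ≪≫ whiskerRightIso (β_ y x') y' ≪≫
    α_ _ _ _) ≪≫ (α_ _ _ _).symm ≪≫ (e ⊗ᵢ e') ≪≫ λ_ _⟩

lemma IsTensorInverse.tensorPow (h : IsTensorInverse x x') (n : ℕ) :
    IsTensorInverse (tensorPow x n) (tensorPow x' n) := by
  induction n with
  | zero => exact isTensorInverse_unit C
  | succ n ih => exact h.tensor ih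

lemma IsTensorInverse.tensorZPow (h : IsTensorInverse x x') (n : ℤ) :
    IsTensorInverse (tensorZPow x x' n) (tensorZPow x x' (-n)) := by
  match n with
  | .ofNat 0 => exact isTensorInverse_unit C
  | .ofNat (m + 1) => exact h.tensorPow (m + 1)
  | .negSucc m => exact h.symm.tensorPow (m + 1)

lemma IsTensorInverse.nonempty_tensorZPow_tensor_iso (h : IsTensorInverse x x') (n : ℤ) :
    Nonempty (TT.tensorZPow x x' n ⊗ x ≅ TT.tensorZPow x x' (n + 1)) := by
  obtain ⟨e⟩ := h
  match n with
  | .ofNat m => exact ⟨β_ _ _⟩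
  | .negSucc 0 =>
    exact ⟨β_ _ _ ≪≫ (α_ _ _ _).symm ≪≫ whiskerRightIso e _ ≪≫ λ_ _⟩
  | .negSucc (m + 1) =>
    exact ⟨β_ _ _ ≪≫ (α_ _ _ _).symm ≪≫ whiskerRightIso e _ ≪≫ λ_ _⟩

end Invertible

section Towers

variable {C : Type u₁} [Category.{v} C] {D : Type u₂} [Category.{v} D] {F : D ⥤ C}

namespace AdjointTower

instance (T : AdjointTower F) (n : ℤ) : (T.up n).IsLeftAdjoint :=
  (T.adjUp n).isLeftAdjoint

instance (T : AdjointTower F) (n : ℤ) : (T.up n).IsRightAdjoint := by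
  simpa only [sub_add_cancel] using (T.adjDown (n - 1)).isRightAdjoint

instance (T : AdjointTower F) (n : ℤ) : (T.down n).IsLeftAdjoint := by
  simpa only [neg_neg] using (T.adjDown (-n)).isLeftAdjoint

instance (T : AdjointTower F) (n : ℤ) : (T.down n).IsRightAdjoint := by
  simpa only [neg_neg] using (T.adjUp (-n)).isRightAdjoint

lemma nonempty_up_iso (T T' : AdjointTower F) (n : ℤ) : Nonempty (T.up n ≅ T'.up n) := by
  induction n using Int.induction_on with
  | zero => exact ⟨T.upZeroIso ≪≫ T'.upZeroIso.symm⟩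
  | succ n ih =>
    obtain ⟨e⟩ := ih
    have e' := ((T.adjUp n).ofNatIsoLeft e).rightAdjointUniq (T'.adjUp n)
    exact ⟨((T.adjDown n).ofNatIsoLeft e').rightAdjointUniq (T'.adjDown n)⟩
  | pred n ih =>
    obtain ⟨m, hm⟩ : ∃ m : ℤ, m = -(n : ℤ) - 1 := ⟨_, rfl⟩
    obtain ⟨e⟩ : Nonempty (T.up (m + 1) ≅ T'.up (m + 1)) := by
      rwa [show m + 1 = -(n : ℤ) by lia]
    have e' := ((T.adjDown m).ofNatIsoRight e).leftAdjointUniq (T'.adjDown m)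
    exact hm ▸ ⟨((T.adjUp m).ofNatIsoRight e').leftAdjointUniq (T'.adjUp m)⟩

lemma nonempty_down_iso (T T' : AdjointTower F) (n : ℤ) : Nonempty (T.down n ≅ T'.down n) := by
  obtain ⟨e⟩ := T.nonempty_up_iso T' (-n)
  have e' := ((T.adjUp (-n)).ofNatIsoLeft e).rightAdjointUniq (T'.adjUp (-n))
  rw [neg_neg] at e'
  exact ⟨e'⟩

lemma nonempty_down_neg_one_iso (T : AdjointTower F) {R N : C ⥤ D} {U : D ⥤ C} (adj₂ : F ⊣ R)
    (adj₃ : R ⊣ U) (adj₄ : U ⊣ N) : Nonempty (T.down (-1) ≅ N) := by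
  have e₀ : T.down (-0) ≅ R := ((T.adjUp 0).ofNatIsoLeft T.upZeroIso).rightAdjointUniq adj₂
  have e₁ : T.up 1 ≅ U := ((T.adjDown 0).ofNatIsoLeft e₀).rightAdjointUniq adj₃
  exact ⟨((T.adjUp 1).ofNatIsoLeft e₁).rightAdjointUniq adj₄⟩

end AdjointTower

lemma additive_of_isLeftAdjoint {A : Type*} [Category* A] {B : Type*} [Category* B]
    [Preadditive A] [Preadditive B] [HasBinaryBiproducts A] (G : A ⥤ B)
    [G.IsLeftAdjoint] : G.Additive := by
  have := preservesBinaryBiproducts_of_preservesBinaryCoproducts G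
  exact Functor.additive_of_preservesBinaryBiproducts G

section Preadditive

variable [Preadditive C] [Preadditive D]

lemma AdjointTower.preservesCompacts_up [HasBinaryBiproducts D]
    (T : AdjointTower F) (n : ℤ) : PreservesCompacts (T.up n) :=
  have := additive_of_isLeftAdjoint (T.up n)
  .of_adjunction (T.adjUp n) (.of_isLeftAdjoint _)

lemma AdjointTower.preservesCompacts_down [HasBinaryBiproducts C]
    (T : AdjointTower F) (n : ℤ) : PreservesCompacts (T.down n) := by
  have := additive_of_isLeftAdjoint (T.down (-(-n)))
  have h := PreservesCompacts.of_adjunction (T.adjDown (-n)) (.of_isLeftAdjoint _)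
  rwa [neg_neg] at h

end Preadditive

variable [MonoidalCategory C] [BraidedCategory C] {R : C ⥤ D} {U : D ⥤ C}

/-- The tower of adjoints obtained from `F ⊣ R ⊣ U` with `U ≅ x ⊗ F -` by twisting with the
powers of the invertible object `x`. -/
noncomputable def twistTower (adj₂ : F ⊣ R) (adj₃ : R ⊣ U) {x x' : C} (h : IsTensorInverse x x')
    (e : U ≅ F ⋙ tensorLeft x) : AdjointTower F where
  up n := F ⋙ tensorLeft (tensorZPow x x' n)
  down n := tensorLeft (tensorZPow x x' n) ⋙ R
  upZeroIso := Functor.isoWhiskerLeft F (leftUnitorNatIso C) ≪≫ F.rightUnitor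
  adjUp n := adj₂.comp (h.tensorZPow n).adjunction
  adjDown n := ((h.tensorZPow n).symm.adjunction.comp adj₃).ofNatIsoRight
    (Functor.isoWhiskerRight e _ ≪≫ Functor.associator _ _ _ ≪≫
      Functor.isoWhiskerLeft F ((tensorLeftTensor _ _).symm ≪≫
        (curriedTensor C).mapIso (h.nonempty_tensorZPow_tensor_iso n).some))

end Towers

section Faithful

variable {C : Type u₁} [Category.{v} C] [SplitEpiCategory C] {D : Type u₂} [Category.{v} D]
  {F : D ⥤ C} {R : C ⥤ D}

lemma nonempty_retract_of_faithful (adj : F ⊣ R) [R.Faithful] (x : C) :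
    Nonempty (Retract x (F.obj (R.obj x))) :=
  have := isSplitEpi_of_epi (adj.counit.app x)
  ⟨section_ (adj.counit.app x), adj.counit.app x, IsSplitEpi.id _⟩

lemma faithful_iff_retract (adj : F ⊣ R) :
    R.Faithful ↔ ∀ x : C, ∃ y : D, Nonempty (Retract x (F.obj y)) := by
  refine ⟨fun _ x => ⟨R.obj x, nonempty_retract_of_faithful adj x⟩, fun h => ?_⟩
  have (x : C) : Epi (adj.counit.app x) := by
    obtain ⟨y, ⟨r⟩⟩ := h x
    have hr : F.map (adj.unit.app y ≫ R.map r.r) ≫ adj.counit.app x = r.r := by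
      simp
    exact epi_of_epi_fac hr
  exact adj.faithful_R_of_epi_counit_app

lemma isCompactObj_of_faithful [Preadditive C] [Preadditive D] [F.Additive] (adj : F ⊣ R)
    [R.Faithful] (hR : PreservesAllCoproducts R) {x : C} (hx : IsCompactObj (R.obj x)) :
    IsCompactObj x := by
  obtain ⟨r⟩ := nonempty_retract_of_faithful adj x
  exact (PreservesCompacts.of_adjunction adj hR _ hx).of_retract r

end Faithful

section FormalWirthmuller

variable {C : Type u₁} [Category.{v} C] {D : Type u₂} [Category.{v} D]
  [MonoidalCategory C] [MonoidalClosed C] {F : D ⥤ C} {L R : C ⥤ D} {U : D ⥤ C}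

/-- If `L ⊣ F ≅ hom(w, U -)` and `R ⊣ U`, then `L ≅ R (w ⊗ -)`. -/
noncomputable def leftAdjointIso (adj₁ : L ⊣ F) (adj₃ : R ⊣ U) {w : C} (e : F ≅ U ⋙ ihom w) :
    L ≅ tensorLeft w ⋙ R :=
  (adj₁.ofNatIsoRight e).leftAdjointUniq ((ihom.adjunction w).comp adj₃)

variable [BraidedCategory C]

/-- If `F ≅ hom(w, U -)` with `w` invertible, then `U ≅ w ⊗ F -`. -/
noncomputable def IsTensorInverse.isoOfIsoIhom {w w' : C} (h : IsTensorInverse w w')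
    (e : F ≅ U ⋙ ihom w) : U ≅ F ⋙ tensorLeft w :=
  Iso.isoCompInverse (H := h.symm.equivalence) (Functor.isoWhiskerLeft U
    (h.adjunction.rightAdjointUniq (ihom.adjunction w)) ≪≫ e.symm)

lemma isTensorInvertible_of_isIso {w : C} (e : (ihom w).obj w ≅ 𝟙_ C)
    [IsIso (dualTensorToHom w w)] : IsTensorInvertible w :=
  ⟨(ihom w).obj (𝟙_ C), ⟨β_ _ _ ≪≫ asIso (dualTensorToHom w w) ≪≫ e⟩⟩

lemma IsRigidlyCompactlyGenerated.isTensorInvertible_of_isCompactObj [Preadditive C]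
    (hC : IsRigidlyCompactlyGenerated C) {w : C} (e : (ihom w).obj w ≅ 𝟙_ C)
    (hw : IsCompactObj w) : IsTensorInvertible w :=
  have := (hC.compact_iff_rigid w).1 hw w
  isTensorInvertible_of_isIso e

end FormalWirthmuller

section ProductPreservation

variable {D : Type u₂} [Category.{v} D] [Preadditive D] [MonoidalCategory D]

section Preadditive

variable {C : Type u₁} [Category.{v} C] [Preadditive C] [MonoidalCategory C] [BraidedCategory C]
  {F : D ⥤ C} [F.Monoidal] [F.Additive] {R : C ⥤ D}

/-- For `F ⊣ R` with `F` strong monoidal and `d` with dual `d'`, the isomorphism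
`Hom(d, - ⊗ w) ≅ Hom(𝟙, R (w ⊗ (d' ⊗ -)))` of functors to abelian groups. -/
noncomputable def tensorRightCompCoyonedaIso (adj : F ⊣ R) (w d' d : C) [ExactPairing d' d]
    [(tensorLeft d).Additive] :
    tensorRight w ⋙ preadditiveCoyoneda.obj (op d) ≅
      tensorLeft d' ⋙ (tensorLeft w ⋙ R) ⋙ preadditiveCoyoneda.obj (op (𝟙_ D)) :=
  calc tensorRight w ⋙ preadditiveCoyoneda.obj (op d)
    _ ≅ tensorRight w ⋙ preadditiveCoyoneda.obj (op (d ⊗ 𝟙_ C)) :=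
      Functor.isoWhiskerLeft _ (preadditiveCoyoneda.mapIso (ρ_ d).op)
    _ ≅ tensorRight w ⋙ tensorLeft d' ⋙ preadditiveCoyoneda.obj (op (𝟙_ C)) :=
      Functor.isoWhiskerLeft _ (preadditiveCoyonedaAdjIso (tensorLeftAdjunction d' d) (𝟙_ C))
    _ ≅ (tensorRight w ⋙ tensorLeft d') ⋙ preadditiveCoyoneda.obj (op (F.obj (𝟙_ D))) :=
      (Functor.associator _ _ _).symm ≪≫
        Functor.isoWhiskerLeft _ (preadditiveCoyoneda.mapIso (Functor.Monoidal.εIso F).symm.op)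
    _ ≅ (tensorLeft d' ⋙ tensorLeft w) ⋙ R ⋙ preadditiveCoyoneda.obj (op (𝟙_ D)) :=
      Functor.isoWhiskerLeft _ (preadditiveCoyonedaAdjIso adj (𝟙_ D)) ≪≫
        Functor.isoWhiskerRight (NatIso.ofComponents
          (fun x => (α_ d' x w).symm ≪≫ β_ (d' ⊗ x) w) fun f => by
            simp [-BraidedCategory.braiding_tensor_left_hom,
              ← BraidedCategory.braiding_naturality_left]) _
    _ ≅ tensorLeft d' ⋙ (tensorLeft w ⋙ R) ⋙ preadditiveCoyoneda.obj (op (𝟙_ D)) :=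
      Functor.associator _ _ _ ≪≫ Functor.isoWhiskerLeft _ (Functor.associator _ _ _).symm

lemma IsRigidlyCompactlyGenerated.preservesAllProducts_tensorRight_comp [MonoidalClosed C]
    [∀ x : C, (tensorLeft x).Additive] (hC : IsRigidlyCompactlyGenerated C) (adj : F ⊣ R)
    {w : C} (hw : PreservesAllProducts (tensorLeft w ⋙ R)) {d : C} (hd : IsCompactObj d) :
    PreservesAllProducts (tensorRight w ⋙ preadditiveCoyoneda.obj (op d)) := fun J => by
  obtain ⟨d', ⟨_⟩, -, -⟩ := hC.exists_exactPairing hd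
  have := hw J
  have := (tensorLeftAdjunction d' d).isRightAdjoint
  exact preservesLimitsOfShape_of_natIso (tensorRightCompCoyonedaIso adj w d' d).symm

end Preadditive

lemma IsRigidlyCompactlyGenerated.isTensorInvertible_of_preservesAllProducts
    {C : Type u₁} [Category.{v} C] [Preadditive C] [HasZeroObject C] [HasShift C ℤ]
    [∀ n : ℤ, (shiftFunctor C n).Additive] [Pretriangulated C]
    [MonoidalCategory C] [SymmetricCategory C] [MonoidalClosed C] [TensorTriangulated C]
    {F : D ⥤ C} [F.Monoidal] [F.Additive] {R : C ⥤ D}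
    (hC : IsRigidlyCompactlyGenerated C) (adj : F ⊣ R) {w : C} (e : (ihom w).obj w ≅ 𝟙_ C)
    (hw : PreservesAllProducts (tensorLeft w ⋙ R)) : IsTensorInvertible w :=
  have := isIso_dualTensorToHom_of_preservesAllProducts hC
    (fun _ hd => hC.preservesAllProducts_tensorRight_comp adj hw hd) w
  isTensorInvertible_of_isIso e

end ProductPreservation

section Wirthmuller

variable {C : Type u₁} [Category.{v} C] [Preadditive C] [HasZeroObject C] [HasShift C ℤ]
  [∀ n : ℤ, (shiftFunctor C n).Additive] [Pretriangulated C]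
  [MonoidalCategory C] [SymmetricCategory C] [MonoidalClosed C] [TensorTriangulated C]
  {D : Type u₂} [Category.{v} D] [Preadditive D] [HasZeroObject D] [HasShift D ℤ]
  [∀ n : ℤ, (shiftFunctor D n).Additive] [Pretriangulated D]
  [MonoidalCategory D] [SymmetricCategory D] [MonoidalClosed D] [TensorTriangulated D]
  {F : D ⥤ C} [F.Braided] [F.CommShift ℤ] [F.IsTriangulated]
  {L R N : C ⥤ D} {U : D ⥤ C}

theorem isCompactObj_dualizing_of_detects (hC : IsRigidlyCompactlyGenerated C)
    (hD : IsRigidlyCompactlyGenerated D) (adj₁ : L ⊣ F) (adj₂ : F ⊣ R) (adj₃ : R ⊣ U)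
    (hU : PreservesAllCoproducts U)
    (h : ∀ x : C, (∀ y : C, IsCompactObj y → IsCompactObj (R.obj (x ⊗ y))) → IsCompactObj x) :
    IsCompactObj (U.obj (𝟙_ D)) := by
  have := adj₁.left_adjoint_additive
  have hL : PreservesCompacts L :=
    .of_adjunction adj₁ (have := adj₂.isLeftAdjoint; .of_isLeftAdjoint F)
  let eL := leftAdjointIso adj₁ adj₃ (isoIhomDualizing hC hD adj₂ adj₃ hU)
  exact h _ fun y hy => (hL y hy).of_iso (eL.app y).symm

theorem tfae_wirthmuller (hC : IsRigidlyCompactlyGenerated C)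
    (hD : IsRigidlyCompactlyGenerated D) (adj₁ : L ⊣ F) (adj₂ : F ⊣ R) (adj₃ : R ⊣ U)
    (adj₄ : U ⊣ N) :
    List.TFAE [
      L.IsRightAdjoint,
      PreservesAllProducts L,
      N.IsLeftAdjoint,
      PreservesAllCoproducts N,
      PreservesCompacts U,
      IsCompactObj (U.obj (𝟙_ D)),
      IsTensorInvertible (U.obj (𝟙_ D)),
      ∃ w : C, IsTensorInvertible w ∧ Nonempty (L ≅ tensorLeft w ⋙ R),
      ∃ w w' : C, IsTensorInverse w w' ∧ Nonempty (R ≅ tensorLeft w' ⋙ L),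
      Nonempty (AdjointTower F)] := by
  have := adj₂.right_adjoint_additive
  have := adj₃.right_adjoint_additive
  have := adj₄.isLeftAdjoint
  let e := isoIhomDualizing hC hD adj₂ adj₃ (.of_isLeftAdjoint U)
  let eUnit := (e.app (𝟙_ D)).symm ≪≫ (Functor.Monoidal.εIso F).symm
  let eL := leftAdjointIso adj₁ adj₃ e
  tfae_have 1 → 2 := fun _ => .of_isRightAdjoint L
  tfae_have 2 → 7 := fun h => hC.isTensorInvertible_of_preservesAllProducts adj₂ eUnit fun J =>
    have := h J
    preservesLimitsOfShape_of_natIso eL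
  tfae_have 7 → 8 := fun h => ⟨_, h, ⟨eL⟩⟩
  tfae_have 8 → 9 := fun ⟨w, ⟨w', h⟩, e⟩ => ⟨w, w', h, (h.nonempty_iso_comp_iff _ _).1 e⟩
  tfae_have 9 → 8 := fun ⟨w, w', h, e⟩ => ⟨w, ⟨w', h⟩, (h.nonempty_iso_comp_iff _ _).2 e⟩
  tfae_have 8 → 1 := fun ⟨w, ⟨w', h⟩, ⟨e⟩⟩ =>
    ((adj₂.comp h.symm.adjunction).ofNatIsoRight e.symm).isRightAdjoint
  tfae_have 7 → 10 := fun ⟨_, h⟩ => ⟨twistTower adj₂ adj₃ h (h.isoOfIsoIhom e)⟩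
  tfae_have 10 → 3 := fun ⟨T⟩ =>
    have ⟨e⟩ := T.nonempty_down_neg_one_iso adj₂ adj₃ adj₄
    Functor.isLeftAdjoint_of_iso e
  tfae_have 3 → 4 := fun _ => .of_isLeftAdjoint N
  tfae_have 4 → 5 := fun h => .of_adjunction adj₄ h
  tfae_have 5 → 6 := fun h => h _ hD.isCompactObj_unit
  tfae_have 6 → 7 := hC.isTensorInvertible_of_isCompactObj eUnit
  tfae_finish

end Wirthmuller

end TT

theorem mainTheorem2_general
    {C : Type u₁} [Category.{v} C] [Preadditive C] [HasZeroObject C] [HasShift C ℤ]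
    [∀ n : ℤ, (shiftFunctor C n).Additive] [Pretriangulated C]
    [MonoidalCategory C] [SymmetricCategory C] [MonoidalClosed C] [TT.TensorTriangulated C]
    {D : Type u₂} [Category.{v} D] [Preadditive D] [HasZeroObject D] [HasShift D ℤ]
    [∀ n : ℤ, (shiftFunctor D n).Additive] [Pretriangulated D]
    [MonoidalCategory D] [SymmetricCategory D] [MonoidalClosed D] [TT.TensorTriangulated D]
    (hC : TT.IsRigidlyCompactlyGenerated C) (hD : TT.IsRigidlyCompactlyGenerated D)
    (fPull : D ⥤ C) [fPull.Braided] [fPull.CommShift ℤ] [fPull.IsTriangulated]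
    (fLow1 : C ⥤ D) (fPush : C ⥤ D) (fUp1 : D ⥤ C) (fLowNeg1 : C ⥤ D)
    (adj₁ : fLow1 ⊣ fPull) (adj₂ : fPull ⊣ fPush) (adj₃ : fPush ⊣ fUp1)
    (adj₄ : fUp1 ⊣ fLowNeg1)
    (ω : C) (hω : ω = fUp1.obj (𝟙_ D)) :
    List.TFAE [
      fLow1.IsRightAdjoint,
      TT.PreservesAllProducts fLow1,
      fLowNeg1.IsLeftAdjoint,
      TT.PreservesAllCoproducts fLowNeg1,
      TT.PreservesCompacts fUp1,
      TT.IsCompactObj ω,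
      TT.IsTensorInvertible ω,
      ∃ w : C, TT.IsTensorInvertible w ∧ Nonempty (fLow1 ≅ tensorLeft w ⋙ fPush),
      ∃ w w' : C, TT.IsTensorInverse w w' ∧ Nonempty (fPush ≅ tensorLeft w' ⋙ fLow1),
      Nonempty (TT.AdjointTower fPull)] ∧
    (∀ w w' : C, TT.IsTensorInverse w w' →
      (Nonempty (fLow1 ≅ tensorLeft w ⋙ fPush) ↔ Nonempty (fPush ≅ tensorLeft w' ⋙ fLow1))) ∧
    (∀ (T : TT.AdjointTower fPull) (n : ℤ),
      (TT.PreservesAllCoproducts (T.up n) ∧ TT.PreservesAllProducts (T.up n) ∧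
        TT.PreservesCompacts (T.up n)) ∧
      (TT.PreservesAllCoproducts (T.down n) ∧ TT.PreservesAllProducts (T.down n) ∧
        TT.PreservesCompacts (T.down n))) ∧
    (∀ (T : TT.AdjointTower fPull) (ω' : C), TT.IsTensorInverse ω ω' → ∀ n : ℤ,
      Nonempty (T.up n ≅ fPull ⋙ tensorLeft (TT.tensorZPow ω ω' n)) ∧
      Nonempty (T.down n ≅ tensorLeft (TT.tensorZPow ω ω' n) ⋙ fPush)) ∧
    (fPush.Faithful ↔ ∀ x : C, ∃ y : D, Nonempty (Retract x (fPull.obj y))) ∧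
    (fPush.Faithful → ∀ x : C, TT.IsCompactObj (fPush.obj x) → TT.IsCompactObj x) ∧
    ((∀ x : C, TT.IsCompactObj (fPush.obj x) → TT.IsCompactObj x) →
      ∀ x : C, (∀ y : C, TT.IsCompactObj y → TT.IsCompactObj (fPush.obj (x ⊗ y))) →
        TT.IsCompactObj x) ∧
    ((fPush.Faithful ∨
      (∀ x : C, TT.IsCompactObj (fPush.obj x) → TT.IsCompactObj x) ∨
      (∀ x : C, (∀ y : C, TT.IsCompactObj y → TT.IsCompactObj (fPush.obj (x ⊗ y))) →
        TT.IsCompactObj x)) →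
      TT.IsCompactObj ω) := by
  subst hω
  have := adj₃.isLeftAdjoint
  have := adj₄.isLeftAdjoint
  have hPush : TT.PreservesAllCoproducts fPush := .of_isLeftAdjoint fPush
  have hUp1 : TT.PreservesAllCoproducts fUp1 := .of_isLeftAdjoint fUp1
  have faithful_imp (_ : fPush.Faithful) (x : C) (hx : TT.IsCompactObj (fPush.obj x)) :
      TT.IsCompactObj x := TT.isCompactObj_of_faithful adj₂ hPush hx
  have reflects_imp (h : ∀ x : C, TT.IsCompactObj (fPush.obj x) → TT.IsCompactObj x) (x : C)
      (hx : ∀ y : C, TT.IsCompactObj y → TT.IsCompactObj (fPush.obj (x ⊗ y))) :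
      TT.IsCompactObj x :=
    h x ((hx _ hC.isCompactObj_unit).of_iso (fPush.mapIso (ρ_ x).symm))
  have detects_imp := TT.isCompactObj_dualizing_of_detects hC hD adj₁ adj₂ adj₃ hUp1
  refine ⟨TT.tfae_wirthmuller hC hD adj₁ adj₂ adj₃ adj₄,
    fun w w' h => h.nonempty_iso_comp_iff fLow1 fPush,
    fun T n => ⟨⟨.of_isLeftAdjoint _, .of_isRightAdjoint _, T.preservesCompacts_up n⟩,
      .of_isLeftAdjoint _, .of_isRightAdjoint _, T.preservesCompacts_down n⟩,
    fun T ω' h n => ?_, TT.faithful_iff_retract adj₂, faithful_imp, reflects_imp, ?_⟩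
  · let T' := TT.twistTower adj₂ adj₃ h
      (h.isoOfIsoIhom (TT.isoIhomDualizing hC hD adj₂ adj₃ hUp1))
    exact ⟨T.nonempty_up_iso T' n, T.nonempty_down_iso T' n⟩
  · rintro (h | h | h)
    exacts [detects_imp (reflects_imp (faithful_imp h)), detects_imp (reflects_imp h),
      detects_imp h]

theorem mainTheorem2
    {C : Type u₁} [Category.{v} C] [Preadditive C] [HasZeroObject C] [HasShift C ℤ]
    [∀ n : ℤ, (shiftFunctor C n).Additive] [Pretriangulated C] [IsTriangulated C]
    [MonoidalCategory C] [SymmetricCategory C] [MonoidalClosed C] [TT.TensorTriangulated C]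
    {D : Type u₂} [Category.{v} D] [Preadditive D] [HasZeroObject D] [HasShift D ℤ]
    [∀ n : ℤ, (shiftFunctor D n).Additive] [Pretriangulated D] [IsTriangulated D]
    [MonoidalCategory D] [SymmetricCategory D] [MonoidalClosed D] [TT.TensorTriangulated D]
    (hC : TT.IsRigidlyCompactlyGenerated C) (hD : TT.IsRigidlyCompactlyGenerated D)
    -- the coproduct-preserving tensor-exact functor `f^*`
    (fPull : D ⥤ C) [fPull.Braided] [fPull.CommShift ℤ] [fPull.IsTriangulated]
    (hf : TT.PreservesAllCoproducts fPull)
    -- the five adjoints `f_{(1)} ⊣ f^* ⊣ f_* ⊣ f^{(1)} ⊣ f_{(-1)}`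
    (fLow1 : C ⥤ D) (fPush : C ⥤ D) (fUp1 : D ⥤ C) (fLowNeg1 : C ⥤ D)
    (adj₁ : fLow1 ⊣ fPull) (adj₂ : fPull ⊣ fPush) (adj₃ : fPush ⊣ fUp1)
    (adj₄ : fUp1 ⊣ fLowNeg1)
    -- the relative dualizing object
    (ω : C) (hω : ω = fUp1.obj (𝟙_ D)) :
    -- the equivalent conditions
    List.TFAE [
      fLow1.IsRightAdjoint,
      TT.PreservesAllProducts fLow1,
      fLowNeg1.IsLeftAdjoint,
      TT.PreservesAllCoproducts fLowNeg1,
      TT.PreservesCompacts fUp1,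
      TT.IsCompactObj ω,
      TT.IsTensorInvertible ω,
      ∃ w : C, TT.IsTensorInvertible w ∧ Nonempty (fLow1 ≅ tensorLeft w ⋙ fPush),
      ∃ w w' : C, TT.IsTensorInverse w w' ∧ Nonempty (fPush ≅ tensorLeft w' ⋙ fLow1),
      Nonempty (TT.AdjointTower fPull)] ∧
    -- the two forms of the Wirthmüller isomorphism are equivalent for each invertible object
    (∀ w w' : C, TT.IsTensorInverse w w' →
      (Nonempty (fLow1 ≅ tensorLeft w ⋙ fPush) ↔ Nonempty (fPush ≅ tensorLeft w' ⋙ fLow1))) ∧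
    -- all functors in a tower preserve coproducts, products and compact objects
    (∀ (T : TT.AdjointTower fPull) (n : ℤ),
      (TT.PreservesAllCoproducts (T.up n) ∧ TT.PreservesAllProducts (T.up n) ∧
        TT.PreservesCompacts (T.up n)) ∧
      (TT.PreservesAllCoproducts (T.down n) ∧ TT.PreservesAllProducts (T.down n) ∧
        TT.PreservesCompacts (T.down n))) ∧
    -- the tower is given by `f^{(n)} = ω^{⊗ n} ⊗ f^*` and `f_{(n)} = f_* (ω^{⊗ n} ⊗ -)`
    (∀ (T : TT.AdjointTower fPull) (ω' : C), TT.IsTensorInverse ω ω' → ∀ n : ℤ,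
      Nonempty (T.up n ≅ fPull ⋙ tensorLeft (TT.tensorZPow ω ω' n)) ∧
      Nonempty (T.down n ≅ tensorLeft (TT.tensorZPow ω ω' n) ⋙ fPush)) ∧
    -- `f_*` is faithful if and only if `f^*` is surjective up to direct summands
    (fPush.Faithful ↔ ∀ x : C, ∃ y : D, Nonempty (Retract x (fPull.obj y))) ∧
    -- the three sufficient conditions, in increasing generality
    (fPush.Faithful → ∀ x : C, TT.IsCompactObj (fPush.obj x) → TT.IsCompactObj x) ∧
    ((∀ x : C, TT.IsCompactObj (fPush.obj x) → TT.IsCompactObj x) →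
      ∀ x : C, (∀ y : C, TT.IsCompactObj y → TT.IsCompactObj (fPush.obj (x ⊗ y))) →
        TT.IsCompactObj x) ∧
    ((fPush.Faithful ∨
      (∀ x : C, TT.IsCompactObj (fPush.obj x) → TT.IsCompactObj x) ∨
      (∀ x : C, (∀ y : C, TT.IsCompactObj y → TT.IsCompactObj (fPush.obj (x ⊗ y))) →
        TT.IsCompactObj x)) →
      TT.IsCompactObj ω) := by
  exact mainTheorem2_general hC hD fPull fLow1 fPush fUp1 fLowNeg1 adj₁ adj₂ adj₃ adj₄ ω hω
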